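/- Let $C$ be a field of characteristic $0$. An iterative derivation (ID) on a ring $A$ is a family of additive maps $\theta^{(n)}:A\to A$, $n\ge 0$, with $\theta^{(0)}=\mathrm{id}$, $\theta^{(n)}(ab)=\sum_{i+j=n}\theta^{(i)}(a)\theta^{(j)}(b)$ and $\theta^{(i)}\circ\theta^{(j)}=\binom{i+j}{i}\theta^{(i+j)}$; an ID-module is a finitely generated module with such a family, satisfying $\theta^{(n)}(am)=\sum_{i+j=n}\theta^{(i)}(a)\theta^{(j)}(m)$. The constants $C_A$ (and those of a module) are the elements killed by all $\theta^{(n)}$, $n>0$; $A\neq 0$ is ID-simple if $0$ and $A$ are its only ideals stable under all $\theta^{(n)}$. In characteristic $0$, $\theta^{(n)}=\frac1{n!}\partial^n$ with $\partial=\theta^{(1)}$. Let $S=C[s,t,\tfrac1{3s^2-1}]/(s^3-s-t^2)$, with the iterative derivation given by the $C$-derivation $\partial$ with $\partial(t)=1$, $\partial(s)=\frac{2t}{3s^2-1}$. Let $M$ be the $S$-module generated by $f_1,f_2$ with relations $tf_1=sf_2$ and $(s^2-1)f_1=tf_2$, and the ID-module structure given by $\partial_M(f_1)=\frac{3s^2+1}{3s^2-1}f_2$,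 $\partial_M(f_2)=sf_1$ (the case $b=0$ of $\partial_M(f_1)=bf_1+\frac{3s^2+1}{3s^2-1}f_2$, $\partial_M(f_2)=sf_1+bf_2$). Regard $C[[t]]$ as an ID-ring with the iterative derivation $\theta(f)(t)=f(t+T)$, and $S$ as a sub-ID-ring of $C[[t]]$ through the Taylor expansion $x\mapsto\sum_n\overline{\theta^{(n)}(x)}\,t^n$ at the rational point $(s,t)=(1,0)$ of $S$. For an ID-simple ID-ring $S$ and an ID-module $M$ over it, a solution ring is an ID-ring $R\ne 0$ with an ID-homomorphism $S\to R$ such that $R\otimes_{C_R}C_{R\otimes_S M}\to R\otimes_S M$ is an isomorphism; a Picard–Vessiot (PV) ring is an ID-simple solution ring $R$ with $C_R=C_S$ such that every injective ID-homomorphism over $S$ from a solution ring into $R$ is an isomorphism. If $C_S=C$, its ID-Galois group is the functor $D\mapsto \mathrm{Aut}^\theta(R\otimes_C D/S\otimes_C D)$ from commutative $C$-algebras to groups ($D$ with the trivial iterative derivation), sending $D$ to the group of ID-automorphisms of $R\otimes_CD$ that fix $S\otimes_C D$. Then $S$ is ID-simple with constants $C$, and the differential equation $$\partial(y)=\frac{(3s^2+1)\,t}{(3s^2-1)\,s}\,y$$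 has a solution $0\ne y\in C[[t]]$. For every such $y$: 1. $y$ and $y/s$ are transcendental over $S$; 2. for no $n\ge 1$ does $(y/s)^n$ lie in $\mathrm{Quot}(S)\subseteq\mathrm{Quot}(C[[t]])$; 3. the subring $R=S[y,\tfrac{yt}{s},\tfrac{s}{y},\tfrac{t}{y}]$ of $C[[t]]$ is stable under the iterative derivation and is a Picard–Vessiot ring for $M$, and its ID-Galois group is isomorphic, as a group functor on commutative $C$-algebras, to $\mathbb G_m$. -/

import Mathlib

open scoped PowerSeries TensorProduct
open Finset

universe u v w

/-! ### Iterative derivations -/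

/-- An iterative derivation on a commutative ring. -/
structure IterDer (R : Type u) [CommRing R] where
  θ : ℕ → R →+ R
  θ_zero : ∀ r, θ 0 r = r
  θ_mul : ∀ n r s, θ n (r * s) = ∑ ij ∈ antidiagonal n, θ ij.1 r * θ ij.2 s
  θ_comp : ∀ i j r, θ i (θ j r) = (i + j).choose i • θ (i + j) r

/-- The Leibniz rule for a family of additive maps on a module over an ID-ring. -/
def LeibnizOver {A : Type u} [CommRing A] (d : IterDer A) {M : Type v} [AddCommGroup M]
    [Module A M] (f : ℕ → M →+ M) : Prop :=
  ∀ n (a : A) (m : M), f n (a • m) = ∑ ij ∈ antidiagonal n, d.θ ij.1 a • f ij.2 m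

/-- The structure of an ID-module over the ID-ring `(S, d)`: a finitely generated module with an
iterative derivation compatible with `d`. -/
structure IterDerModule {S : Type u} [CommRing S] (d : IterDer S) (M : Type v) [AddCommGroup M]
    [Module S M] where
  finite : Module.Finite S M
  θ : ℕ → M →+ M
  θ_zero : ∀ m, θ 0 m = m
  θ_smul : LeibnizOver d θ
  θ_comp : ∀ i j m, θ i (θ j m) = (i + j).choose i • θ (i + j) m

namespace IterDer

lemma θ_one {R : Type u} [CommRing R] (d : IterDer R) (n : ℕ) (hn : 0 < n) : d.θ n 1 = 0 := by
  induction n using Nat.strong_induction_on with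
  | _ n ih =>
    obtain ⟨m, rfl⟩ := Nat.exists_eq_succ_of_ne_zero hn.ne'
    have h := d.θ_mul (m + 1) 1 1
    rw [Nat.sum_antidiagonal_succ, mul_one, d.θ_zero, one_mul] at h
    have h2 : ∑ p ∈ antidiagonal m, d.θ (p.1 + 1) 1 * d.θ p.2 1 = d.θ (m + 1) 1 := by
      rw [Finset.sum_eq_single (m, 0)]
      · simp [d.θ_zero]
      · rintro ⟨i, j⟩ hij hne
        have hij' : i + j = m := by simpa using hij
        have : i < m := by
          rcases Nat.eq_zero_or_pos j with rfl | hj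
          · exact absurd (by simpa using hij') (by rintro rfl; exact hne rfl)
          · omega
        simp [ih (i + 1) (by omega) (by omega)]
      · intro h; simp at h
    simp only [Nat.succ_eq_add_one, h2] at h ⊢
    simpa using h

/-- The ring of constants. -/
def constants {R : Type u} [CommRing R] (d : IterDer R) : Subring R where
  carrier := {r | ∀ n, 0 < n → d.θ n r = 0}
  zero_mem' n _ := map_zero _
  one_mem' n hn := d.θ_one n hn
  add_mem' {a b} ha hb n hn := by rw [map_add, ha n hn, hb n hn, add_zero]
  neg_mem' {a} ha n hn := by rw [map_neg, ha n hn, neg_zero]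
  mul_mem' {a b} ha hb n hn := by
    rw [d.θ_mul]
    refine Finset.sum_eq_zero fun ij hij => ?_
    have : ij.1 + ij.2 = n := by simpa using hij
    rcases Nat.eq_zero_or_pos ij.1 with h | h
    · rw [hb ij.2 (by omega), mul_zero]
    · rw [ha ij.1 h, zero_mul]

/-- An ID-ring is ID-simple if it is non-zero and has no ID-ideals apart from `0` and itself. -/
def IsSimple {R : Type u} [CommRing R] (d : IterDer R) : Prop :=
  Nontrivial R ∧
    ∀ I : Ideal R, (∀ n, ∀ x ∈ I, d.θ n x ∈ I) → I = ⊥ ∨ I = ⊤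

/-- The trivial iterative derivation. -/
def trivial (R : Type u) [CommRing R] : IterDer R where
  θ n := if n = 0 then AddMonoidHom.id R else 0
  θ_zero r := by simp
  θ_mul n r s := by
    rcases n with _ | n
    · simp
    · rw [Nat.sum_antidiagonal_succ]
      simp
  θ_comp i j r := by
    rcases i with _ | i <;> rcases j with _ | j <;> simp

/-- The restriction of an iterative derivation to an ID-stable subalgebra. -/
def restrict {S : Type u} {R : Type v} [CommRing S] [CommRing R] [Algebra S R] (d : IterDer R)
    (A : Subalgebra S R) (h : ∀ n, ∀ x ∈ A, d.θ n x ∈ A) : IterDer A where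
  θ n := ((d.θ n).comp A.toSubring.subtype.toAddMonoidHom).codRestrict A.toSubring
    (fun x => h n x x.2)
  θ_zero r := Subtype.ext (d.θ_zero r)
  θ_mul n r s := Subtype.ext <| by
    simpa using! d.θ_mul n r s
  θ_comp i j r := Subtype.ext <| by
    simpa using! d.θ_comp i j r

end IterDer

/-- `S → R` is a homomorphism of ID-rings. -/
def IsIDExt {S : Type u} {R : Type v} [CommRing S] [CommRing R] [Algebra S R]
    (dS : IterDer S) (dR : IterDer R) : Prop :=
  ∀ n x, dR.θ n (algebraMap S R x) = algebraMap S R (dS.θ n x)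

lemma IsIDExt.leibniz {S : Type u} {R : Type v} [CommRing S] [CommRing R] [Algebra S R]
    {dS : IterDer S} {dR : IterDer R} (h : IsIDExt dS dR) : LeibnizOver dS dR.θ := by
  intro n a m
  rw [Algebra.smul_def, dR.θ_mul]
  exact Finset.sum_congr rfl fun ij _ => by rw [h, Algebra.smul_def]

lemma IsIDExt.restrict {S : Type u} {R : Type v} [CommRing S] [CommRing R] [Algebra S R]
    {dS : IterDer S} {dR : IterDer R} (h : IsIDExt dS dR)
    (A : Subalgebra S R) (hA : ∀ n, ∀ x ∈ A, dR.θ n x ∈ A) : IsIDExt dS (dR.restrict A hA) :=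
  fun n x => Subtype.ext (h n x)

lemma IsIDExt.comp {C : Type w} {S : Type u} {R : Type v} [CommRing C] [CommRing S] [CommRing R]
    [Algebra C S] [Algebra S R] [Algebra C R] [IsScalarTower C S R]
    {dC : IterDer C} {dS : IterDer S} {dR : IterDer R} (h : IsIDExt dC dS) (h' : IsIDExt dS dR) :
    IsIDExt dC dR := fun n x => by
  rw [IsScalarTower.algebraMap_apply C S R, h', h, ← IsScalarTower.algebraMap_apply]

/-! ### Tensor products -/

section Tensor

variable {A : Type u} [CommRing A] {M : Type v} {N : Type w} [AddCommGroup M] [Module A M]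
  [AddCommGroup N] [Module A N]

/-- The iterative derivation `θ⁽ᵏ⁾(m ⊗ n) = ∑_{i+j=k} θ⁽ⁱ⁾(m) ⊗ θ⁽ʲ⁾(n)` on a tensor product over
an ID-ring. -/
noncomputable def tensorTheta (dA : IterDer A) (f : ℕ → M →+ M) (g : ℕ → N →+ N)
    (hf : LeibnizOver dA f) (hg : LeibnizOver dA g) (k : ℕ) : M ⊗[A] N →+ M ⊗[A] N :=
  TensorProduct.liftAddHom
    (∑ ij ∈ antidiagonal k,
      ((AddMonoidHom.compHom.flip (g ij.2)).comp
        (AddMonoidHom.comp (AddMonoidHom.mk' (fun m : M =>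
            (TensorProduct.mk A M N m).toAddMonoidHom) (fun a b => by
              ext n; simp)) (f ij.1))))
    (by
      intro a m n
      simp only [AddMonoidHom.finsetSum_apply]
      change ∑ ij ∈ antidiagonal k, f ij.1 (a • m) ⊗ₜ[A] g ij.2 n
        = ∑ ij ∈ antidiagonal k, f ij.1 m ⊗ₜ[A] g ij.2 (a • n)
      simp only [hf _ a, hg _ a, TensorProduct.sum_tmul, TensorProduct.tmul_sum,
        TensorProduct.smul_tmul]
      rw [Finset.sum_sigma', Finset.sum_sigma']
      refine Finset.sum_bij'
        (fun x _ => ⟨(x.2.2, x.2.1 + x.1.2), (x.2.1, x.1.2)⟩)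
        (fun x _ => ⟨(x.2.1 + x.1.1, x.2.2), (x.2.1, x.1.1)⟩) ?_ ?_ ?_ ?_ ?_
      · rintro ⟨⟨i, j⟩, ⟨p, q⟩⟩ h
        simp only [mem_sigma, HasAntidiagonal.mem_antidiagonal] at h ⊢
        exact ⟨by omega, True.intro⟩
      · rintro ⟨⟨i, j⟩, ⟨p, q⟩⟩ h
        simp only [mem_sigma, HasAntidiagonal.mem_antidiagonal] at h ⊢
        exact ⟨by omega, True.intro⟩
      · rintro ⟨⟨i, j⟩, ⟨p, q⟩⟩ h
        simp only [mem_sigma, HasAntidiagonal.mem_antidiagonal] at h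
        obtain ⟨h1, rfl⟩ := h
        rfl
      · rintro ⟨⟨i, j⟩, ⟨p, q⟩⟩ h
        simp only [mem_sigma, HasAntidiagonal.mem_antidiagonal] at h
        obtain ⟨h1, rfl⟩ := h
        rfl
      · rintro ⟨⟨i, j⟩, ⟨p, q⟩⟩ h
        rfl)

lemma tensorTheta_tmul (dA : IterDer A) (f : ℕ → M →+ M) (g : ℕ → N →+ N)
    (hf : LeibnizOver dA f) (hg : LeibnizOver dA g) (k : ℕ) (m : M) (n : N) :
    tensorTheta dA f g hf hg k (m ⊗ₜ n) =
      ∑ ij ∈ antidiagonal k, f ij.1 m ⊗ₜ[A] g ij.2 n := by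
  simp only [tensorTheta, TensorProduct.liftAddHom_tmul, AddMonoidHom.finsetSum_apply]
  rfl

end Tensor

/-! ### Solution rings and Picard-Vessiot rings -/

section PV

variable {S : Type u} [CommRing S] {dS : IterDer S} {M : Type w} [AddCommGroup M] [Module S M]
  (dM : IterDerModule dS M) {R : Type v} [CommRing R] [Algebra S R] {dR : IterDer R}

/-- The iterative derivation on `R ⊗_S M`. -/
noncomputable def baseChangeTheta (h : IsIDExt dS dR) (k : ℕ) : R ⊗[S] M →+ R ⊗[S] M :=
  tensorTheta dS dR.θ dM.θ h.leibniz dM.θ_smul k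

/-- The constants `C_{R ⊗_S M}`, as a module over the constants `C_R`. -/
noncomputable def baseChangeConstants (h : IsIDExt dS dR) :
    Submodule dR.constants (R ⊗[S] M) where
  carrier := {x | ∀ n, 0 < n → baseChangeTheta dM h n x = 0}
  zero_mem' n _ := map_zero _
  add_mem' {a b} ha hb n hn := by rw [map_add, ha n hn, hb n hn, add_zero]
  smul_mem' c x hx n hn := by
    have key : ∀ z : R ⊗[S] M,
        baseChangeTheta dM h n (c • z) = c • baseChangeTheta dM h n z := by
      intro z
      induction z with
      | zero => simp
      | add a b ha hb => rw [smul_add, map_add, ha, hb, map_add, smul_add]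
      | tmul r m =>
        have hc : ∀ i, dR.θ i ((c : R) * r) = c * dR.θ i r := by
          intro i
          rw [dR.θ_mul, Finset.sum_eq_single (0, i)]
          · rw [dR.θ_zero]
          · rintro ⟨p, q⟩ hpq hne
            have : p + q = i := by simpa using hpq
            have hp : 0 < p := by
              rcases Nat.eq_zero_or_pos p with rfl | hp
              · exact absurd (by simpa using this) (by rintro rfl; exact hne rfl)
              · exact hp
            rw [c.2 p hp, zero_mul]
          · intro h; simp at h
        change baseChangeTheta dM h n (((c : R) * r) ⊗ₜ m) = _
        simp only [baseChangeTheta, tensorTheta_tmul, hc, Finset.smul_sum]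
        rfl
    rw [key, hx n hn, smul_zero]

/-- The natural map `R ⊗_{C_R} C_{R ⊗_S M} → R ⊗_S M`. -/
noncomputable def solutionMap (h : IsIDExt dS dR) :
    R ⊗[dR.constants] (baseChangeConstants dM h) →ₗ[R] R ⊗[S] M :=
  (baseChangeConstants dM h).subtype.liftBaseChange R

variable (dR) in
/-- `(R, dR)` is a solution ring for the ID-module `M`. -/
def IsSolutionRing : Prop :=
  Nontrivial R ∧ ∃ h : IsIDExt dS dR, Function.Bijective (solutionMap dM h)

variable (dR) in
/-- `(R, dR)` is a Picard-Vessiot ring for the ID-module `M`: an ID-simple solution ring with the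
same constants as `S` and such that every injective `S`-linear ID-homomorphism from another
solution ring into `R` is an isomorphism. -/
def IsPicardVessiotRing : Prop :=
  IsSolutionRing dM dR ∧ dR.IsSimple ∧
  dR.constants = dS.constants.map (algebraMap S R) ∧
  ∀ (R' : Type v) [CommRing R'] [Algebra S R'] (dR' : IterDer R'), IsSolutionRing dM dR' →
    ∀ g : R' →ₐ[S] R, (∀ n x, g (dR'.θ n x) = dR.θ n (g x)) → Function.Injective g →
      Function.Bijective g

end PV

/-! ### The ID-Galois group scheme -/

section Galois

open CategoryTheory

variable {C : Type u} [CommRing C] {S : Type v} [CommRing S] [Algebra C S]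
  {R : Type w} [CommRing R] [Algebra C R] [Algebra S R] [IsScalarTower C S R] {dR : IterDer R}

/-- The iterative derivation on `R ⊗_C D`, where `C` and `D` carry the trivial one. -/
noncomputable def scalarTheta (h : IsIDExt (IterDer.trivial C) dR) (D : Type*) [CommRing D]
    [Algebra C D] (k : ℕ) : R ⊗[C] D →+ R ⊗[C] D :=
  tensorTheta (IterDer.trivial C) dR.θ (IterDer.trivial D).θ h.leibniz
    (IsIDExt.leibniz (fun n x => by by_cases hn : n = 0 <;> simp [IterDer.trivial, hn])) k

lemma scalarTheta_tmul (h : IsIDExt (IterDer.trivial C) dR) (D : Type*) [CommRing D]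
    [Algebra C D] (k : ℕ) (r : R) (x : D) :
    scalarTheta h D k (r ⊗ₜ x) = dR.θ k r ⊗ₜ x := by
  rw [scalarTheta, tensorTheta_tmul, Finset.sum_eq_single (k, 0)]
  · simp [IterDer.trivial]
  · rintro ⟨p, q⟩ hpq hne
    have h1 : p + q = k := by simpa using hpq
    have hq : q ≠ 0 := by
      rintro rfl
      exact hne (by simpa using h1)
    simp [IterDer.trivial, hq]
  · intro h; simp at h

variable (S) in
/-- The natural map `S ⊗_C D → R ⊗_C D`. -/
noncomputable def scalarMap (D : Type*) [CommRing D] [Algebra C D] : S ⊗[C] D →ₐ[C] R ⊗[C] D :=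
  Algebra.TensorProduct.map (IsScalarTower.toAlgHom C S R) (AlgHom.id C D)

variable (S) in
/-- The group of ID-automorphisms of `R ⊗_C D` fixing the image of `S ⊗_C D`. -/
def galGroup (h : IsIDExt (IterDer.trivial C) dR) (D : Type*) [CommRing D] [Algebra C D] :
    Subgroup ((R ⊗[C] D) ≃ₐ[C] (R ⊗[C] D)) where
  carrier := {σ | (∀ x : S ⊗[C] D, σ (scalarMap S D x) = scalarMap S D x) ∧
    ∀ k x, σ (scalarTheta h D k x) = scalarTheta h D k (σ x)}
  one_mem' := ⟨fun _ => rfl, fun _ _ => rfl⟩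
  mul_mem' {σ τ} hσ hτ :=
    ⟨fun x => by rw [AlgEquiv.mul_apply, hτ.1, hσ.1],
      fun k x => by rw [AlgEquiv.mul_apply, hτ.2, hσ.2, AlgEquiv.mul_apply]⟩
  inv_mem' {σ} hσ :=
    ⟨fun x => σ.injective (by rw [hσ.1]; exact σ.apply_symm_apply _),
      fun k x => σ.injective (by
        rw [hσ.2]
        exact (σ.apply_symm_apply _).trans (congrArg _ (σ.apply_symm_apply _).symm))⟩

/-- The map `R ⊗_C D → R ⊗_C D'` induced by `φ : D → D'`. -/
noncomputable abbrev scalarChange (R : Type w) [CommRing R] [Algebra C R] {D D' : Type*}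
    [CommRing D] [CommRing D'] [Algebra C D] [Algebra C D'] (φ : D →ₐ[C] D') :
    R ⊗[C] D →ₐ[C] R ⊗[C] D' :=
  Algebra.TensorProduct.map (AlgHom.id C R) φ

/-- The base change of an endomorphism of `R ⊗_C D` along `φ : D → D'`: the `D'`-linear
endomorphism of `R ⊗_C D'` sending `r ⊗ 1` to the image of `σ (r ⊗ 1)`. -/
noncomputable def scalarExtend {D D' : Type*} [CommRing D] [CommRing D'] [Algebra C D]
    [Algebra C D'] (φ : D →ₐ[C] D') (σ : R ⊗[C] D →ₐ[C] R ⊗[C] D) :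
    R ⊗[C] D' →ₐ[C] R ⊗[C] D' :=
  Algebra.TensorProduct.lift
    (((scalarChange R φ).comp σ).comp Algebra.TensorProduct.includeLeft)
    Algebra.TensorProduct.includeRight (fun _ _ => Commute.all _ _)

lemma scalarExtend_tmul {D D' : Type*} [CommRing D] [CommRing D'] [Algebra C D]
    [Algebra C D'] (φ : D →ₐ[C] D') (σ : R ⊗[C] D →ₐ[C] R ⊗[C] D) (r : R) (x : D') :
    scalarExtend φ σ (r ⊗ₜ x) = scalarChange R φ (σ (r ⊗ₜ 1)) * (1 ⊗ₜ x) := by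
  simp [scalarExtend]

variable (S) in
lemma galGroup_one_tmul {h : IsIDExt (IterDer.trivial C) dR} {D : Type*} [CommRing D]
    [Algebra C D] {σ : (R ⊗[C] D) ≃ₐ[C] (R ⊗[C] D)} (hσ : σ ∈ galGroup S h D) (x : D) :
    σ (1 ⊗ₜ x) = 1 ⊗ₜ x := by
  have := hσ.1 (1 ⊗ₜ x)
  simpa [scalarMap] using this

variable (S) in
lemma scalarExtend_scalarChange {h : IsIDExt (IterDer.trivial C) dR} {D D' : Type*} [CommRing D]
    [CommRing D'] [Algebra C D] [Algebra C D'] (φ : D →ₐ[C] D')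
    {σ : (R ⊗[C] D) ≃ₐ[C] (R ⊗[C] D)} (hσ : σ ∈ galGroup S h D) (x : R ⊗[C] D) :
    scalarExtend φ σ.toAlgHom (scalarChange R φ x) = scalarChange R φ (σ x) := by
  induction x with
  | zero => simp
  | add a b ha hb => rw [map_add, map_add, ha, hb, map_add, map_add]
  | tmul r x =>
    have h1 : r ⊗ₜ[C] x = (r ⊗ₜ[C] (1 : D)) * ((1 : R) ⊗ₜ[C] x) := by simp
    have h2 : σ ((1 : R) ⊗ₜ[C] (1 : D)) = 1 := map_one σ
    rw [h1, map_mul σ, galGroup_one_tmul S hσ, map_mul, map_mul, map_mul]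
    simp only [scalarExtend_tmul, Algebra.TensorProduct.map_tmul, map_one]
    erw [h2]
    rw [map_one, one_mul, ← Algebra.TensorProduct.one_def, mul_one]
    rfl

variable (S) in
lemma scalarExtend_mul {h : IsIDExt (IterDer.trivial C) dR} {D D' : Type*} [CommRing D]
    [CommRing D'] [Algebra C D] [Algebra C D'] (φ : D →ₐ[C] D')
    {σ τ : (R ⊗[C] D) ≃ₐ[C] (R ⊗[C] D)} (hσ : σ ∈ galGroup S h D) (x : R ⊗[C] D') :
    scalarExtend φ σ.toAlgHom (scalarExtend φ τ.toAlgHom x)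
      = scalarExtend φ (σ * τ).toAlgHom x := by
  induction x with
  | zero => simp
  | add a b ha hb => rw [map_add, map_add, ha, hb, map_add]
  | tmul r x =>
    rw [scalarExtend_tmul, scalarExtend_tmul, map_mul]
    erw [scalarExtend_scalarChange S φ hσ]
    rw [scalarExtend_tmul]
    have h2 : σ ((1 : R) ⊗ₜ[C] (1 : D)) = 1 := map_one σ
    simp [h2]

lemma scalarExtend_one {D D' : Type*} [CommRing D]
    [CommRing D'] [Algebra C D] [Algebra C D'] (φ : D →ₐ[C] D') (x : R ⊗[C] D') :
    scalarExtend φ (1 : (R ⊗[C] D) ≃ₐ[C] (R ⊗[C] D)).toAlgHom x = x := by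
  induction x with
  | zero => simp
  | add a b ha hb => rw [map_add, ha, hb]
  | tmul r x =>
    rw [scalarExtend_tmul]
    simp

lemma scalarTheta_scalarChange (h : IsIDExt (IterDer.trivial C) dR) {D D' : Type*} [CommRing D]
    [CommRing D'] [Algebra C D] [Algebra C D'] (φ : D →ₐ[C] D') (k : ℕ) (x : R ⊗[C] D) :
    scalarTheta h D' k (scalarChange R φ x) = scalarChange R φ (scalarTheta h D k x) := by
  induction x with
  | zero => simp
  | add a b ha hb => simp only [map_add, ha, hb]
  | tmul r x => simp [scalarTheta_tmul]

lemma scalarTheta_mul_one_tmul (h : IsIDExt (IterDer.trivial C) dR) {D : Type*} [CommRing D]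
    [Algebra C D] (k : ℕ) (x : R ⊗[C] D) (y : D) :
    scalarTheta h D k (x * (1 ⊗ₜ y)) = scalarTheta h D k x * (1 ⊗ₜ y) := by
  induction x with
  | zero => simp
  | add a b ha hb => simp only [map_add, ha, hb, add_mul]
  | tmul r x => simp [scalarTheta_tmul]

variable (S) in
lemma scalarExtend_mem {h : IsIDExt (IterDer.trivial C) dR} {D D' : Type*} [CommRing D]
    [CommRing D'] [Algebra C D] [Algebra C D'] (φ : D →ₐ[C] D')
    {σ : (R ⊗[C] D) ≃ₐ[C] (R ⊗[C] D)} (hσ : σ ∈ galGroup S h D) :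
    (∀ x : S ⊗[C] D', scalarExtend φ σ.toAlgHom (scalarMap S D' x) = scalarMap S D' x) ∧
    ∀ k x, scalarExtend φ σ.toAlgHom (scalarTheta h D' k x)
      = scalarTheta h D' k (scalarExtend φ σ.toAlgHom x) := by
  constructor
  · intro x
    induction x with
    | zero => simp
    | add a b ha hb => rw [map_add, map_add, ha, hb]
    | tmul r x =>
      have h1 := hσ.1 (r ⊗ₜ 1)
      simp only [scalarMap, Algebra.TensorProduct.map_tmul, map_one] at h1 ⊢
      rw [scalarExtend_tmul]
      erw [h1]
      simp
  · intro k x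
    induction x with
    | zero => simp
    | add a b ha hb => simp only [map_add, ha, hb]
    | tmul r x =>
      have h1 := hσ.2 k (r ⊗ₜ 1)
      rw [scalarTheta_tmul] at h1 ⊢
      rw [scalarExtend_tmul, scalarExtend_tmul, scalarTheta_mul_one_tmul,
        scalarTheta_scalarChange]
      erw [h1]
      rfl

variable (S) in
/-- Functoriality of the Galois group in the coefficient algebra: base change of automorphisms. -/
noncomputable def galMap (h : IsIDExt (IterDer.trivial C) dR) {D D' : Type*} [CommRing D]
    [CommRing D'] [Algebra C D] [Algebra C D'] (φ : D →ₐ[C] D') :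
    galGroup S h D →* galGroup S h D' where
  toFun σ :=
    ⟨AlgEquiv.ofAlgHom (scalarExtend φ σ.1.toAlgHom) (scalarExtend φ (σ⁻¹).1.toAlgHom)
      (AlgHom.ext fun x => by
        refine (scalarExtend_mul S φ σ.2 x).trans ?_
        rw [← Subgroup.coe_mul, mul_inv_cancel]
        exact scalarExtend_one φ x)
      (AlgHom.ext fun x => by
        refine (scalarExtend_mul S φ (σ⁻¹).2 x).trans ?_
        rw [← Subgroup.coe_mul, inv_mul_cancel]
        exact scalarExtend_one φ x), scalarExtend_mem S φ σ.2⟩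
  map_one' := Subtype.ext (AlgEquiv.ext fun x => scalarExtend_one φ x)
  map_mul' σ τ := Subtype.ext (AlgEquiv.ext fun x => (scalarExtend_mul S φ σ.2 x).symm)

variable (S) in
/-- The ID-Galois group functor `D ↦ Aut^θ(R ⊗_C D / S ⊗_C D)` on commutative `C`-algebras. -/
noncomputable def galFunctor (h : IsIDExt (IterDer.trivial C) dR) :
    CommAlgCat.{u} C ⥤ GrpCat.{max u w} where
  obj D := GrpCat.of (galGroup S h D)
  map f := GrpCat.ofHom (galMap S h f.hom)
  map_id D := by
    refine GrpCat.hom_ext (MonoidHom.ext fun (σ : galGroup S h D) => ?_)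
    refine Subtype.ext (AlgEquiv.ext fun x => ?_)
    change scalarExtend (AlgHom.id C D) σ.1.toAlgHom x = σ.1 x
    have := scalarExtend_scalarChange S (AlgHom.id C D) σ.2 x
    simpa [scalarChange] using this
  map_comp {D D' D''} f g := by
    refine GrpCat.hom_ext (MonoidHom.ext fun (σ : galGroup S h D) => ?_)
    refine Subtype.ext (AlgEquiv.ext fun x => ?_)
    change scalarExtend (g.hom.comp f.hom) σ.1.toAlgHom x
      = scalarExtend g.hom (galMap S h f.hom σ).1.toAlgHom x
    induction x with
    | zero => simp
    | add a b ha hb => rw [map_add, ha, hb, map_add]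
    | tmul r x =>
      rw [scalarExtend_tmul, scalarExtend_tmul]
      congr 1
      change _ = scalarChange R g.hom (scalarExtend f.hom σ.1.toAlgHom (r ⊗ₜ 1))
      rw [scalarExtend_tmul]
      have : ((1 : R) ⊗ₜ[C] (1 : D')) = 1 := rfl
      rw [this, mul_one]
      generalize σ.1.toAlgHom (r ⊗ₜ[C] 1) = z
      induction z with
      | zero => simp
      | add a b ha hb => simp only [map_add, ha, hb]
      | tmul a b => simp

/-- The multiplicative group `D ↦ Dˣ` on commutative `C`-algebras. -/
def gmFunctor (C : Type u) [CommRing C] : CommAlgCat.{u} C ⥤ GrpCat.{u} where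
  obj D := GrpCat.of Dˣ
  map f := GrpCat.ofHom (Units.map f.hom)

end Galois

/-! ### Iterative derivations in characteristic zero -/

section CharZero

variable {C : Type u} [Field C]

/-- The divided powers `θ⁽ⁿ⁾ = (1 / n!) ∂ⁿ` of a linear map. -/
noncomputable def dividedPow {M : Type w} [AddCommGroup M] [Module C M] (δ : M →ₗ[C] M) (n : ℕ) :
    M →+ M :=
  ((n.factorial : C)⁻¹ • δ ^ n).toAddMonoidHom

lemma dividedPow_apply {M : Type w} [AddCommGroup M] [Module C M] (δ : M →ₗ[C] M) (n : ℕ)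
    (m : M) : dividedPow δ n m = (n.factorial : C)⁻¹ • (δ ^ n) m := rfl

lemma dividedPow_zero {M : Type w} [AddCommGroup M] [Module C M] (δ : M →ₗ[C] M)
    (m : M) : dividedPow δ 0 m = m := by
  simp [dividedPow_apply]

variable [CharZero C]

lemma dividedPow_comp {M : Type w} [AddCommGroup M] [Module C M] (δ : M →ₗ[C] M) (i j : ℕ)
    (m : M) : dividedPow δ i (dividedPow δ j m) = (i + j).choose i • dividedPow δ (i + j) m := by
  simp only [dividedPow_apply, map_smul]
  rw [← Module.End.mul_apply, ← pow_add, smul_smul, ← Nat.cast_smul_eq_nsmul C, smul_smul]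
  congr 1
  have hi : (i.factorial : C) ≠ 0 := Nat.cast_ne_zero.2 i.factorial_ne_zero
  have hj : (j.factorial : C) ≠ 0 := Nat.cast_ne_zero.2 j.factorial_ne_zero
  have hk : ((i + j).factorial : C) ≠ 0 := Nat.cast_ne_zero.2 (i + j).factorial_ne_zero
  have h : ((i + j).choose i * i.factorial * j.factorial : C) = (i + j).factorial := by
    exact_mod_cast (Nat.choose_symm_add (a := i) (b := j)).symm ▸
      Nat.add_choose_mul_factorial_mul_factorial i j
  field_simp
  rw [← h]
  ring

lemma dividedPow_smul {S : Type v} [CommRing S] [Algebra C S] {M : Type w} [AddCommGroup M]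
    [Module C M] [Module S M] [IsScalarTower C S M] (D : Derivation C S S) (δ : M →ₗ[C] M)
    (hδ : ∀ (a : S) (m : M), δ (a • m) = D a • m + a • δ m) (n : ℕ) (a : S) (m : M) :
    dividedPow δ n (a • m) =
      ∑ ij ∈ antidiagonal n, dividedPow D.toLinearMap ij.1 a • dividedPow δ ij.2 m := by
  have h : ∀ n, (δ ^ n) (a • m) =
      ∑ ij ∈ antidiagonal n, n.choose ij.1 • ((D.toLinearMap ^ ij.1) a • (δ ^ ij.2) m) := by
    intro n
    induction n with
    | zero => simp
    | succ n ih =>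
      rw [sum_antidiagonal_choose_succ_nsmul
        (M := M) (fun i j => (D.toLinearMap ^ i) a • (δ ^ j) m) n]
      simp only [pow_succ', Module.End.mul_apply, ih, map_sum, map_nsmul, hδ, smul_add,
        sum_add_distrib]
      rw [add_comm]
      congr 1
      refine sum_congr rfl fun ⟨i, j⟩ hij ↦ ?_
      rw [n.choose_symm_of_eq_add (mem_antidiagonal.1 hij).symm]
      rfl
  rw [dividedPow_apply, h, Finset.smul_sum]
  refine sum_congr rfl fun ⟨i, j⟩ hij ↦ ?_
  obtain rfl : i + j = n := by simpa using hij
  simp only [dividedPow_apply]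
  have hi : (i.factorial : C) ≠ 0 := Nat.cast_ne_zero.2 i.factorial_ne_zero
  have hj : (j.factorial : C) ≠ 0 := Nat.cast_ne_zero.2 j.factorial_ne_zero
  have hk : ((i + j).factorial : C) ≠ 0 := Nat.cast_ne_zero.2 (i + j).factorial_ne_zero
  have h : ((i + j).choose i * i.factorial * j.factorial : C) = (i + j).factorial := by
    exact_mod_cast (Nat.choose_symm_add (a := i) (b := j)).symm ▸
      Nat.add_choose_mul_factorial_mul_factorial i j
  have hc : ((i + j).factorial : C)⁻¹ * ((i + j).choose i : C)
      = (i.factorial : C)⁻¹ * (j.factorial : C)⁻¹ := by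
    field_simp
    rw [← h]
  rw [← Nat.cast_smul_eq_nsmul C, smul_smul, hc, smul_assoc, mul_smul]
  congr 1
  rw [← algebraMap_smul S (j.factorial : C)⁻¹, ← algebraMap_smul S (j.factorial : C)⁻¹,
    smul_smul, smul_smul, mul_comm]

/-- The iterative derivation attached to a derivation in characteristic zero. -/
noncomputable def IterDer.ofDerivation {R : Type v} [CommRing R] [Algebra C R]
    (D : Derivation C R R) : IterDer R where
  θ := dividedPow D.toLinearMap
  θ_zero := dividedPow_zero _
  θ_mul n r s := dividedPow_smul D D.toLinearMap
    (fun a b => by simp [add_comm, mul_comm]) n r s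
  θ_comp := dividedPow_comp _

/-- The ID-module attached to a module with a derivation in characteristic zero. -/
noncomputable def IterDerModule.ofDerivation {S : Type v} [CommRing S] [Algebra C S]
    (D : Derivation C S S) {M : Type w} [AddCommGroup M] [Module C M] [Module S M]
    [IsScalarTower C S M] (fin : Module.Finite S M) (δ : M →ₗ[C] M)
    (hδ : ∀ (a : S) (m : M), δ (a • m) = D a • m + a • δ m) :
    IterDerModule (IterDer.ofDerivation D) M where
  finite := fin
  θ := dividedPow δ
  θ_zero := dividedPow_zero _
  θ_smul := dividedPow_smul D δ hδ
  θ_comp := dividedPow_comp _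

/-- The iterative derivation with respect to `t` on `C⟦t⟧`. -/
noncomputable def powerSeriesIterDer (C : Type u) [Field C] [CharZero C] : IterDer C⟦X⟧ :=
  IterDer.ofDerivation (PowerSeries.derivative C)

/-- `θ⁽ⁿ⁾(∑ aᵢ tⁱ) = ∑ aᵢ (i choose n) tⁱ⁻ⁿ`, that is, `θ(f)(t) = f(t + T)`. -/
lemma coeff_powerSeriesIterDer (n k : ℕ) (f : C⟦X⟧) :
    PowerSeries.coeff k ((powerSeriesIterDer C).θ n f)
      = (k + n).choose n * PowerSeries.coeff (k + n) f := by
  change PowerSeries.coeff k ((n.factorial : C)⁻¹ •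
    ((PowerSeries.derivative C).toLinearMap ^ n) f) = _
  rw [Module.End.pow_apply, PowerSeries.coeff_smul]
  erw [PowerSeries.coeff_iterate_derivative]
  have hn : (n.factorial : C) ≠ 0 := Nat.cast_ne_zero.2 n.factorial_ne_zero
  rw [Nat.ascFactorial_eq_factorial_mul_choose]
  push_cast
  field_simp
  rw [smul_eq_mul]
  field_simp

end CharZero

/-! ### The ring `S = C[s, t, 1 / (3s² - 1)] / (s³ - s - t²)` -/

section Curve

/-- The ring `C[s, t] / (t² - (s³ - s))`. -/
abbrev CurveRing (C : Type u) [Field C] : Type u :=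
  AdjoinRoot (Polynomial.X ^ 2 - Polynomial.C (Polynomial.X ^ 3 - Polynomial.X) :
    Polynomial (Polynomial C))

variable (C : Type u) [Field C]

/-- The element `3s² - 1` of `C[s, t] / (t² - (s³ - s))`. -/
noncomputable abbrev curveDisc : CurveRing C :=
  3 * algebraMap (Polynomial C) (CurveRing C) Polynomial.X ^ 2 - 1

/-- The ring `S = C[s, t, 1 / (3s² - 1)] / (s³ - s - t²)`. -/
def RingS : Type u := Localization.Away (curveDisc C)

noncomputable instance : CommRing (RingS C) :=
  inferInstanceAs (CommRing (Localization.Away (curveDisc C)))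

noncomputable instance : Algebra (CurveRing C) (RingS C) :=
  inferInstanceAs (Algebra (CurveRing C) (Localization.Away (curveDisc C)))

noncomputable instance : Algebra C (RingS C) :=
  inferInstanceAs (Algebra C (Localization.Away (curveDisc C)))

instance : IsScalarTower C (CurveRing C) (RingS C) :=
  inferInstanceAs (IsScalarTower C (CurveRing C) (Localization.Away (curveDisc C)))

instance : IsLocalization.Away (curveDisc C) (RingS C) :=
  inferInstanceAs (IsLocalization.Away (curveDisc C) (Localization.Away (curveDisc C)))

namespace RingS

/-- The element `s` of `S`. -/
noncomputable def s : RingS C :=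
  algebraMap (CurveRing C) (RingS C) (algebraMap (Polynomial C) (CurveRing C) Polynomial.X)

/-- The element `t` of `S`. -/
noncomputable def t : RingS C :=
  algebraMap (CurveRing C) (RingS C) (AdjoinRoot.root _)

/-- The element `1 / (3s² - 1)` of `S`. -/
noncomputable def discInv : RingS C := IsLocalization.Away.invSelf (curveDisc C)

lemma disc_mul_discInv : (3 * s C ^ 2 - 1) * discInv C = 1 := by
  have := IsLocalization.Away.mul_invSelf (S := RingS C) (curveDisc C)
  simpa [s, discInv, map_ofNat (algebraMap (CurveRing C) (RingS C)) 3] using! this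

lemma t_sq : t C ^ 2 = s C ^ 3 - s C := by
  have h := AdjoinRoot.eval₂_root
    (Polynomial.X ^ 2 - Polynomial.C (Polynomial.X ^ 3 - Polynomial.X) :
      Polynomial (Polynomial C))
  simp only [Polynomial.eval₂_sub, Polynomial.eval₂_pow, Polynomial.eval₂_X,
    Polynomial.eval₂_C] at h
  have h2 := congrArg (algebraMap (CurveRing C) (RingS C)) (sub_eq_zero.1 h)
  simpa [t, s] using! h2

variable {C} in
/-- The universal property of `S`. -/
noncomputable def lift {T : Type v} [CommRing T] [Algebra C T] (a b c : T)
    (hab : b ^ 2 = a ^ 3 - a) (hc : (3 * a ^ 2 - 1) * c = 1) : RingS C →ₐ[C] T :=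
  IsLocalization.liftAlgHom (M := Submonoid.powers (curveDisc C))
    (f := AdjoinRoot.liftAlgHom _ (Polynomial.aeval a) b (by
      rw [Polynomial.eval₂_sub, Polynomial.eval₂_pow, Polynomial.eval₂_X, Polynomial.eval₂_C, hab]
      simp))
    (by
      rintro ⟨_, n, rfl⟩
      have h : IsUnit (3 * a ^ 2 - 1) := IsUnit.of_mul_eq_one _ hc
      have h3 : ∀ g : CurveRing C →ₐ[C] T, g 3 = 3 := fun g => map_ofNat g 3
      simpa [AdjoinRoot.algebraMap_eq, h3] using h.pow n)

section lift
variable {C} {T : Type v} [CommRing T] [Algebra C T] {a b c : T}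
    (hab : b ^ 2 = a ^ 3 - a) (hc : (3 * a ^ 2 - 1) * c = 1)

lemma lift_s : lift a b c hab hc (s C) = a := by
  simp [lift, s, AdjoinRoot.algebraMap_eq]

lemma lift_t : lift a b c hab hc (t C) = b := by
  simp [lift, t]

end lift

variable {C} in
lemma algHom_ext {T : Type v} [CommRing T] [Algebra C T] {f g : RingS C →ₐ[C] T}
    (hs : f (s C) = g (s C)) (ht : f (t C) = g (t C)) : f = g := by
  refine IsLocalization.algHom_ext (Submonoid.powers (curveDisc C)) (A := CurveRing C) ?_
  refine AdjoinRoot.algHom_ext' ?_ ?_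
  · refine Polynomial.algHom_ext ?_
    simpa [s] using! hs
  · simpa [t] using! ht

/-- The homomorphism `x ↦ x + ∂(x) ε` from `S` to the dual numbers over `S`. -/
noncomputable def dualHom : RingS C →ₐ[C] TrivSqZeroExt (RingS C) (RingS C) :=
  lift (.inl (s C) + .inr (2 * t C * discInv C)) (.inl (t C) + .inr 1)
    (.inl (discInv C) - .inr (12 * s C * t C * discInv C ^ 3))
    (by
      have h1 := t_sq C
      have h2 := disc_mul_discInv C
      ext
      · simpa [pow_succ] using h1
      · simp [pow_succ]
        linear_combination (-2 * t C) * h2)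
    (by
      have h2 := disc_mul_discInv C
      have h3 : (3 : TrivSqZeroExt (RingS C) (RingS C)) = .inl 3 := rfl
      ext
      · simpa [h3, pow_succ] using h2
      · simp [h3, pow_succ]
        linear_combination (-12 * s C * t C * discInv C ^ 2) * h2)

lemma fst_dualHom (x : RingS C) : (dualHom C x).fst = x := by
  have : (TrivSqZeroExt.fstHom C (RingS C) (RingS C)).comp (dualHom C) = AlgHom.id C _ := by
    apply algHom_ext
    · simp [dualHom, lift_s]
    · simp [dualHom, lift_t]
  exact DFunLike.congr_fun this x

/-- The `C`-derivation `∂` of `S` extending `d/dt` on `C[t]`, determined by `∂(t) = 1`. -/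
noncomputable def der : Derivation C (RingS C) (RingS C) :=
  Derivation.mk' ((TrivSqZeroExt.sndHom (RingS C) (RingS C)).restrictScalars C ∘ₗ
    (dualHom C).toLinearMap) (fun a b => by
      simp [fst_dualHom, mul_comm])

lemma der_t : der C (t C) = 1 := by
  simp [der, dualHom, lift_t]

lemma der_s : der C (s C) = 2 * t C * discInv C := by
  simp [der, dualHom, lift_s]

variable [CharZero C]

/-- The iterative derivation of `S` extending the one with respect to `t` on `C[t]`. -/
noncomputable def iterDer : IterDer (RingS C) := IterDer.ofDerivation (der C)

lemma isIDExt : IsIDExt (IterDer.trivial C) (iterDer C) := by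
  intro n x
  rcases n with _ | n
  · simp [IterDer.trivial, IterDer.θ_zero]
  · have : ((der C).toLinearMap ^ (n + 1)) (algebraMap C (RingS C) x) = 0 := by
      rw [pow_succ, Module.End.mul_apply]
      simp
    simp [IterDer.trivial, iterDer, IterDer.ofDerivation, dividedPow_apply, this]

/-- Evaluation at the `C`-rational point `(s, t) = (1, 0)`, whose kernel is `(s - 1, t)`. -/
noncomputable def evalPoint : RingS C →ₐ[C] C :=
  lift 1 0 2⁻¹ (by simp) (by norm_num)

/-- The ID-embedding `S → C⟦t⟧`, `x ↦ ∑ θ⁽ⁿ⁾(x)(1, 0) tⁿ`, at the rational point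
`(s, t) = (1, 0)`. -/
noncomputable def taylor : RingS C →+* C⟦X⟧ where
  toFun x := PowerSeries.mk fun n => evalPoint C ((iterDer C).θ n x)
  map_zero' := by ext; simp
  map_one' := by
    ext n
    rcases Nat.eq_zero_or_pos n with rfl | hn
    · simp [IterDer.θ_zero]
    · simp [IterDer.θ_one _ n hn, PowerSeries.coeff_one, hn.ne']
  map_add' x y := by ext; simp
  map_mul' x y := by
    ext n
    simp [PowerSeries.coeff_mul, IterDer.θ_mul]

noncomputable instance : Algebra (RingS C) C⟦X⟧ := (taylor C).toAlgebra

lemma algebraMap_eq : algebraMap (RingS C) C⟦X⟧ = taylor C := rfl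

instance : IsScalarTower C (RingS C) C⟦X⟧ := by
  refine IsScalarTower.of_algebraMap_eq fun x => ?_
  ext n
  have h := isIDExt C n x
  simp only [algebraMap_eq, taylor, RingHom.coe_mk, MonoidHom.coe_mk, OneHom.coe_mk,
    PowerSeries.coeff_mk, h]
  rcases n with _ | n
  · simp [IterDer.trivial]
  · simp [IterDer.trivial]

lemma isIDExt_powerSeries : IsIDExt (iterDer C) (powerSeriesIterDer C) := by
  intro n x
  ext k
  rw [coeff_powerSeriesIterDer]
  simp only [algebraMap_eq, taylor, RingHom.coe_mk, MonoidHom.coe_mk, OneHom.coe_mk,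
    PowerSeries.coeff_mk, IterDer.θ_comp]
  rw [map_nsmul, nsmul_eq_mul, Nat.choose_symm_add]

/-! ### The ID-module and its solutions -/

/-- The relations `t f₁ - s f₂ = 0` and `(s² - 1) f₁ - t f₂ = 0`. -/
noncomputable def relations (C : Type u) [Field C] : Submodule (RingS C) (RingS C × RingS C) :=
  Submodule.span (RingS C) {(t C, -s C), (s C ^ 2 - 1, -t C)}

/-- The `S`-module generated by `f₁`, `f₂` subject to `t f₁ = s f₂` and `(s² - 1) f₁ = t f₂`. -/
abbrev ModM (C : Type u) [Field C] : Type u := (RingS C × RingS C) ⧸ relations C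

section ModM
variable {C : Type u} [Field C]

/-- The lift to the free module of the derivation
`∂(f₁) = b f₁ + (3s² + 1)/(3s² - 1) f₂`, `∂(f₂) = s f₁ + b f₂`. -/
noncomputable def freeDer (b : RingS C) : (RingS C × RingS C) →ₗ[C] (RingS C × RingS C) where
  toFun x := (der C x.1 + x.1 * b + x.2 * s C,
    der C x.2 + x.1 * ((3 * s C ^ 2 + 1) * discInv C) + x.2 * b)
  map_add' x y := by
    ext <;> simp <;> ring
  map_smul' c x := by
    ext <;> simp [smul_add]

lemma freeDer_smul (b a : RingS C) (x : RingS C × RingS C) :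
    freeDer b (a • x) = der C a • x + a • freeDer b x := by
  ext <;> simp [freeDer] <;> ring

lemma freeDer_mem (b : RingS C) (x : RingS C × RingS C) (hx : x ∈ relations C) :
    freeDer b x ∈ relations C := by
  have h1 : (t C, -s C) ∈ relations C := Submodule.subset_span (by simp)
  have h2 : (s C ^ 2 - 1, -t C) ∈ relations C := Submodule.subset_span (by simp)
  have hd := disc_mul_discInv C
  have ht := t_sq C
  induction hx using Submodule.span_induction with
  | zero => simp
  | add x y hx hy ihx ihy => rw [map_add]; exact add_mem ihx ihy
  | smul a x hx ih =>
    rw [freeDer_smul]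
    exact add_mem (Submodule.smul_mem _ _ hx) (Submodule.smul_mem _ _ ih)
  | mem x hx =>
    rcases hx with rfl | rfl
    · have : freeDer b (t C, -s C) = b • (t C, -s C) + (-1 : RingS C) • (s C ^ 2 - 1, -t C) := by
        ext
        · simp [freeDer, der_t]
          ring
        · simp [freeDer, der_s]
          linear_combination (t C) * hd
      rw [this]
      exact add_mem (Submodule.smul_mem _ _ h1) (Submodule.smul_mem _ _ h2)
    · have : freeDer b (s C ^ 2 - 1, -t C) = b • (s C ^ 2 - 1, -t C) +
          ((5 - 3 * s C ^ 2) * s C * discInv C) • (t C, -s C) := by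
        ext
        · simp [freeDer, der_s]
          linear_combination (s C * t C) * hd
        · simp [freeDer, der_t]
          linear_combination hd
      rw [this]
      exact add_mem (Submodule.smul_mem _ _ h2) (Submodule.smul_mem _ _ h1)

/-- The derivation `∂_M` on `M` with `∂_M(f₁) = b f₁ + (3s² + 1)/(3s² - 1) f₂` and
`∂_M(f₂) = s f₁ + b f₂`. -/
noncomputable def modDer (b : RingS C) : ModM C →ₗ[C] ModM C :=
  ((relations C).restrictScalars C).mapQ ((relations C).restrictScalars C) (freeDer b)
    (freeDer_mem b)

lemma modDer_smul (b a : RingS C) (m : ModM C) :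
    modDer b (a • m) = der C a • m + a • modDer b m := by
  obtain ⟨x, rfl⟩ := Submodule.Quotient.mk_surjective _ m
  change Submodule.Quotient.mk (freeDer b (a • x)) = _
  rw [freeDer_smul]
  rfl

end ModM

/-- The ID-module `(M, θ_M)` over `S` given by `b ∈ S`. -/
noncomputable def iterDerModule (b : RingS C) : IterDerModule (iterDer C) (ModM C) :=
  IterDerModule.ofDerivation (der C) inferInstance (modDer b) (modDer_smul b)

/-- The image of `s` in `C⟦t⟧` (a unit, with constant term `1`). -/
noncomputable def sSeries : C⟦X⟧ := algebraMap (RingS C) C⟦X⟧ (s C)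

/-- The image of `t` in `C⟦t⟧`. -/
noncomputable def tSeries : C⟦X⟧ := algebraMap (RingS C) C⟦X⟧ (t C)

variable {C} in
/-- `y ∈ C⟦t⟧` is a non-zero solution of
`∂(y) = (b + (3s² + 1) / (3s² - 1) · t / s) y`. -/
def IsSolution (b : RingS C) (y : C⟦X⟧) : Prop :=
  y ≠ 0 ∧ PowerSeries.derivative C y =
    (algebraMap (RingS C) C⟦X⟧ b +
      (3 * sSeries C ^ 2 + 1) * (3 * sSeries C ^ 2 - 1)⁻¹ * (tSeries C * (sSeries C)⁻¹)) * y

variable {C} in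
/-- The `S`-subalgebra `S[y, y t / s, s / y, t / y]` of `C⟦t⟧`. -/
noncomputable def pvRing (y : C⟦X⟧) : Subalgebra (RingS C) C⟦X⟧ :=
  Algebra.adjoin (RingS C)
    {y, y * tSeries C * (sSeries C)⁻¹, sSeries C * y⁻¹, tSeries C * y⁻¹}

end RingS

end Curve

/-! Put `z = y / s`. Subtracting the logarithmic derivative `2t / ((3s² - 1)s)` of `s` from that of
`y` leaves `∂z / z = t / s`. Everything rests on one valuation argument at the point at infinity of
the curve `t² = s³ - s`, where `s` and `t` have poles of order 2 and 3. The derivation lowers pole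
orders by at least 3, so the logarithmic derivative of a non-zero element of `Quot(S)` vanishes
there to order at least 3, whereas `k t / s` with `k ≠ 0` has a simple pole. Hence no non-zero
integer power of `z` lies in `Quot(S)`; this is `wronskian_ne`, stated without fractions. The pole
order of `p(s) + q(s) t` is read off as the degree of its norm `p² - q²(s³ - s)`.

From `wronskian_ne`, a shortening argument (`exists_smul_zpow_mem`) shows that an `S`-submodule of
`C⟦t⟧` stable under `∂` and containing a non-trivial combination of powers of `z` contains a
non-zero multiple of a single power. For the zero submodule this says that the powers of `z` are
independent over `S`, which gives transcendence; for an ID-ideal it gives ID-simplicity.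

The ideal `I = (s, t)` satisfies `I² = (s)`, because `t² = s(s² - 1)` and `s = s³ - t²`. So `I⁻¹` is
generated by `1` and `t / s`, and `R = S[y, yt/s, s/y, t/y]` is the graded ring `⊕ Iⁿ zⁿ`. The map
`f₁ ↦ s z`, `f₂ ↦ t z` from `M` to `R` commutes with the derivations. It becomes an isomorphism `R ⊗
M ≅ R` because `I · I⁻¹ = S`, made explicit by `s² - t · (t / s) = 1` (`genRing_partition`).
Therefore `R` is a solution ring, and its constants are those of `C⟦t⟧`. It is minimal, since a
solution ring mapping to `R` has both `I z` and, by means of a non-zero constant solution, `I⁻¹ z⁻¹`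
in its image.

A unit `d` of `D` acts on `R ⊗ D` by `dⁿ` in degree `n`. Conversely an ID-automorphism carries `(s
z, t z)` to a multiple `c · (s z, t z)` with `c` killed by `∂`, and flatness of `D` over `C` puts
`c` in `D`. So the Galois group is `𝔾ₘ`. -/

/-! ### The curve: degrees at infinity and injectivity -/

namespace RingS

section Pair

open Polynomial

variable {C : Type u} [Field C]

/-- The element `p(s) + q(s) t` of `S`. -/
noncomputable def pair (p q : C[X]) : RingS C := aeval (s C) p + aeval (s C) q * t C

/-- The norm `p² - q² (s³ - s)` of `p(s) + q(s) t`. -/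
noncomputable def pairNorm (p q : C[X]) : C[X] := p ^ 2 - q ^ 2 * (X ^ 3 - X)

/-- The two terms of the norm have degrees of different parity, so they cannot cancel. The value is
the pole order at infinity of `p(s) + q(s) t`; it is imported from the coordinate ring of the
Weierstrass curve `Y² = X³ - X`. -/
lemma degree_pairNorm (p q : C[X]) :
    (pairNorm p q).degree = max (2 • p.degree) (2 • q.degree + 3) := by
  let W : WeierstrassCurve.Affine C :=
    { a₁ := 0, a₂ := 0, a₃ := 0, a₄ := -1, a₆ := 0 }
  rw [← WeierstrassCurve.Affine.CoordinateRing.degree_norm_smul_basis (W' := W) p q,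
    WeierstrassCurve.Affine.CoordinateRing.norm_smul_basis]
  congr 1
  simp only [W, pairNorm, map_zero, map_neg, map_one]
  ring

/-- The zero polynomial is split off because its `natDegree` is `0`, which would impose the spurious
condition `3 ≤ n` when `q = 0`. -/
lemma degree_pairNorm_le_iff (p q : C[X]) (n : ℕ) : (pairNorm p q).degree ≤ n ↔
    (p = 0 ∨ 2 * p.natDegree ≤ n) ∧ (q = 0 ∨ 2 * q.natDegree + 3 ≤ n) := by
  rw [degree_pairNorm, max_le_iff]
  refine and_congr ?_ ?_
  · rcases eq_or_ne p 0 with rfl | hp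
    · simp
    · rw [degree_eq_natDegree hp]
      simp only [hp, false_or, two_nsmul, two_mul]
      norm_cast
  · rcases eq_or_ne q 0 with rfl | hq
    · simp
    · rw [degree_eq_natDegree hq]
      simp only [hq, false_or, two_nsmul, two_mul]
      norm_cast

lemma pairNorm_eq_zero {p q : C[X]} (h : pairNorm p q = 0) : p = 0 ∧ q = 0 := by
  have h1 := degree_pairNorm p q
  rw [h, degree_zero, eq_comm, _root_.max_eq_bot] at h1
  refine ⟨?_, ?_⟩
  · by_contra hp
    rw [degree_eq_natDegree hp] at h1
    exact absurd h1.1 WithBot.coe_ne_bot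
  · by_contra hq
    rw [degree_eq_natDegree hq] at h1
    exact absurd h1.2 WithBot.coe_ne_bot

lemma pairNorm_mul (p q p' q' : C[X]) :
    pairNorm (p * p' + q * q' * (X ^ 3 - X)) (p * q' + q * p')
      = pairNorm p q * pairNorm p' q' := by
  simp only [pairNorm]; ring

lemma pair_mul (p q p' q' : C[X]) :
    pair p q * pair p' q' = pair (p * p' + q * q' * (X ^ 3 - X)) (p * q' + q * p') := by
  simp only [pair, map_add, map_mul, map_sub, map_pow, aeval_X]
  linear_combination (aeval (s C) q * aeval (s C) q') * t_sq C

lemma pair_add (p q p' q' : C[X]) : pair p q + pair p' q' = pair (p + p') (q + q') := by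
  simp only [pair, map_add]; ring

lemma pair_sub (p q p' q' : C[X]) : pair p q - pair p' q' = pair (p - p') (q - q') := by
  simp only [pair, map_sub]; ring

lemma isUnit_disc : IsUnit (3 * s C ^ 2 - 1) := IsUnit.of_mul_eq_one _ (disc_mul_discInv C)

lemma exists_pair_eq_algebraMap (x : CurveRing C) :
    ∃ p q : C[X], algebraMap (CurveRing C) (RingS C) x = pair p q := by
  induction x using AdjoinRoot.induction_on with
  | ih f =>
    induction f using Polynomial.induction_on' with
    | add f g hf hg =>
      obtain ⟨p, q, h⟩ := hf
      obtain ⟨p', q', h'⟩ := hg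
      exact ⟨_, _, by rw [map_add, map_add, h, h', pair_add]⟩
    | monomial n a =>
      induction n with
      | zero =>
        refine ⟨a, 0, ?_⟩
        have : (AlgHom.comp (IsScalarTower.toAlgHom C (CurveRing C) (RingS C))
            (IsScalarTower.toAlgHom C C[X] (CurveRing C))) = aeval (s C) :=
          Polynomial.algHom_ext (by simp [s])
        have h := DFunLike.congr_fun this a
        simp only [pair, map_zero, zero_mul, add_zero, ← h]
        rfl
      | succ n ih =>
        obtain ⟨p, q, h⟩ := ih
        have : algebraMap (CurveRing C) (RingS C) (AdjoinRoot.mk _ X) = pair 0 1 := by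
          simp [pair, t]
        exact ⟨_, _, by rw [← monomial_mul_X, map_mul, map_mul, h, this, pair_mul]⟩

lemma exists_pair_eq (x : RingS C) :
    ∃ (n : ℕ) (p q : C[X]), (3 * s C ^ 2 - 1) ^ n * x = pair p q := by
  obtain ⟨⟨a, ⟨_, n, rfl⟩⟩, h⟩ := IsLocalization.surj (Submonoid.powers (curveDisc C)) x
  obtain ⟨p, q, hpq⟩ := exists_pair_eq_algebraMap a
  refine ⟨n, p, q, ?_⟩
  rw [← hpq, ← h, mul_comm]
  simp [s, map_ofNat (algebraMap (CurveRing C) (RingS C)) 3]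

/-- A homomorphism from `S` to a domain is injective if the image of `t` is transcendental. -/
lemma injective_of_transcendental {T : Type v} [CommRing T] [IsDomain T] [Algebra C T]
    (f : RingS C →ₐ[C] T) (hf : Transcendental C (f (t C))) : Function.Injective f := by
  have hs : Transcendental C (f (s C)) := by
    intro h
    refine hf (IsAlgebraic.of_pow (n := 2) two_pos ?_)
    rw [← map_pow, t_sq, map_sub, map_pow]
    exact (h.pow 3).sub h
  rw [injective_iff_map_eq_zero]
  intro x hx
  obtain ⟨n, p, q, h⟩ := exists_pair_eq x
  have h1 : f (pair p q) = 0 := by rw [← h, map_mul, hx, mul_zero]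
  -- Multiplying by the conjugate `p(s) - q(s) t` turns the relation into a polynomial relation for
  -- the image of `s` alone.
  have h2 : aeval (f (s C)) (pairNorm p q) = 0 := by
    have h3 := congrArg f (t_sq C)
    simp only [map_pow, map_sub] at h3
    simp only [pair, map_add, map_mul, ← aeval_algHom_apply] at h1
    simp only [pairNorm, map_sub, map_mul, map_pow, aeval_X]
    linear_combination (aeval (f (s C)) p - aeval (f (s C)) q * f (t C)) * h1 +
      (aeval (f (s C)) q) ^ 2 * h3
  have h3 : pairNorm p q = 0 := by
    by_contra h0
    exact hs ⟨_, h0, h2⟩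
  obtain ⟨rfl, rfl⟩ := pairNorm_eq_zero h3
  have h4 : pair (0 : C[X]) 0 = 0 := by simp [pair]
  rw [h4] at h
  exact ((isUnit_disc.pow n).mul_right_eq_zero).1 h

lemma der_aeval (p : C[X]) :
    der C (aeval (s C) p) = aeval (s C) (derivative p) * (2 * t C * discInv C) := by
  rw [Derivation.map_aeval, der_s, smul_eq_mul]

lemma disc_mul_der_pair (p q : C[X]) : (3 * s C ^ 2 - 1) * der C (pair p q) =
    pair (2 * derivative q * (X ^ 3 - X) + q * (3 * X ^ 2 - 1)) (2 * derivative p) := by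
  simp only [pair, map_add, Derivation.leibniz, der_aeval, der_t, map_mul, map_sub, map_pow,
    aeval_X, map_one, map_ofNat, smul_eq_mul]
  linear_combination (2 * t C * aeval (s C) (derivative p)
    + 2 * t C ^ 2 * aeval (s C) (derivative q)) * disc_mul_discInv C +
    (2 * aeval (s C) (derivative q)) * t_sq C

/-- The derivation `(3s² - 1) ∂` sends `s` to `2t` and `t` to `3s² - 1`, so it raises pole orders at
infinity from 2 to 3 and from 3 to 4: by at most one in general. -/
lemma degree_pairNorm_der_le {p q : C[X]} {n : ℕ} (h : (pairNorm p q).degree ≤ n) :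
    (pairNorm (2 * derivative q * (X ^ 3 - X) + q * (3 * X ^ 2 - 1))
      (2 * derivative p)).degree ≤ (n + 1 : ℕ) := by
  rw [degree_pairNorm_le_iff] at h ⊢
  refine ⟨?_, ?_⟩
  · rcases h.2 with rfl | hq
    · simp
    · right
      have h3 : (2 * derivative q * (X ^ 3 - X)).natDegree ≤ q.natDegree + 2 := by
        -- A constant `q` needs its own case: `natDegree - 1` is truncated there, and the product
        -- bound would come out one too large. The derivative is then zero.
        rcases Nat.eq_zero_or_pos q.natDegree with h0 | h0
        · rw [natDegree_eq_zero.1 h0 |>.choose_spec.symm]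
          simp
        · refine natDegree_mul_le_of_le (m := q.natDegree - 1) (n := 3) ?_ ?_ |>.trans (by omega)
          · refine (natDegree_mul_le_of_le (m := 0) (n := q.natDegree - 1) ?_
              (natDegree_derivative_le q)).trans (by omega)
            exact (natDegree_ofNat 2).le
          · compute_degree
      have h4 : (q * (3 * X ^ 2 - 1)).natDegree ≤ q.natDegree + 2 := by
        refine natDegree_mul_le_of_le le_rfl ?_
        compute_degree
      have := natDegree_add_le_of_degree_le h3 h4
      omega
  · rcases h.1 with rfl | hp
    · simp
    · rcases Nat.eq_zero_or_pos p.natDegree with h0 | h0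
      · left
        rw [natDegree_eq_zero.1 h0 |>.choose_spec.symm]
        simp
      · right
        have : (2 * derivative p).natDegree ≤ 0 + (p.natDegree - 1) :=
          natDegree_mul_le_of_le (natDegree_ofNat 2).le (natDegree_derivative_le p)
        omega

lemma degree_pairNorm_sub_le {p q p' q' : C[X]} {n : ℕ} (h : (pairNorm p q).degree ≤ n)
    (h' : (pairNorm p' q').degree ≤ n) : (pairNorm (p - p') (q - q')).degree ≤ n := by
  rw [degree_pairNorm_le_iff] at h h' ⊢
  have key : ∀ f g : C[X], ∀ k : ℕ, (f = 0 ∨ 2 * f.natDegree + k ≤ n) →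
      (g = 0 ∨ 2 * g.natDegree + k ≤ n) → (f - g = 0 ∨ 2 * (f - g).natDegree + k ≤ n) := by
    rintro f g k (rfl | hf) (rfl | hg)
    · simp
    · right; simpa using hg
    · right; simpa using hf
    · right
      have := natDegree_sub_le f g
      omega
  exact ⟨key p p' 0 h.1 h'.1, key q q' 3 h.2 h'.2⟩

end Pair

end RingS

/-! ### `S` is ID-simple with constants `C` -/

namespace IterDer

/-- The Taylor expansion of an ID-ring at a ring homomorphism. -/
noncomputable def taylorHom {S : Type u} [CommRing S] (d : IterDer S) {L : Type v} [CommRing L]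
    (f : S →+* L) : S →+* L⟦X⟧ where
  toFun x := PowerSeries.mk fun n => f (d.θ n x)
  map_zero' := by ext; simp
  map_one' := by
    ext n
    rcases Nat.eq_zero_or_pos n with rfl | hn
    · simp [d.θ_zero]
    · simp [d.θ_one _ hn, PowerSeries.coeff_one, hn.ne']
  map_add' x y := by ext; simp
  map_mul' x y := by
    ext n
    simp [PowerSeries.coeff_mul, d.θ_mul]

lemma coeff_taylorHom {S : Type u} [CommRing S] (d : IterDer S) {L : Type v} [CommRing L]
    (f : S →+* L) (x : S) (n : ℕ) : PowerSeries.coeff n (d.taylorHom f x) = f (d.θ n x) := by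
  simp [taylorHom]

end IterDer

/-- Evaluating `p` at `a + X` gives the Taylor expansion of `p` at `a`, and Taylor expansion of
polynomials is injective. -/
lemma transcendental_C_add_X {C : Type u} [Field C] {L : Type v} [CommRing L] [IsDomain L]
    [Algebra C L] (a : L) : Transcendental C (PowerSeries.C a + PowerSeries.X : L⟦X⟧) := by
  rintro ⟨p, hp, h⟩
  have h2 : Polynomial.aeval (PowerSeries.C a + PowerSeries.X : L⟦X⟧) p
      = Polynomial.coeToPowerSeries.ringHom (Polynomial.taylor a (p.map (algebraMap C L))) := by
    rw [Polynomial.taylor_apply, Polynomial.comp, Polynomial.eval₂_map, Polynomial.hom_eval₂,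
      Polynomial.aeval_def]
    congr 1
    · ext1 c
      simp [PowerSeries.algebraMap_apply]
    · simp [add_comm]
  rw [h2] at h
  have h3 : Polynomial.taylor a (p.map (algebraMap C L)) = 0 := by
    simpa using h
  rw [(Polynomial.taylor_injective a).eq_iff' (map_zero _),
    Polynomial.map_eq_zero_iff (algebraMap C L).injective] at h3
  exact hp h3

namespace RingS

section Simple

variable {C : Type u} [Field C] [CharZero C]

lemma θ_one_eq (x : RingS C) : (iterDer C).θ 1 x = der C x := by
  simp [iterDer, IterDer.ofDerivation, dividedPow_apply]

lemma θ_t (n : ℕ) : (iterDer C).θ n (t C) = if n = 0 then t C else if n = 1 then 1 else 0 := by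
  rcases n with _ | _ | n
  · simp [IterDer.θ_zero]
  · simp [θ_one_eq, der_t]
  · have : ((der C).toLinearMap ^ (n + 2)) (t C) = 0 := by
      rw [pow_add, Module.End.mul_apply]
      simp [pow_two, der_t]
    simp [iterDer, IterDer.ofDerivation, dividedPow_apply, this]

lemma taylorHom_t {L : Type v} [CommRing L] (f : RingS C →+* L) :
    (iterDer C).taylorHom f (t C) = PowerSeries.C (f (t C)) + PowerSeries.X := by
  ext n
  rcases n with _ | _ | n <;>
    simp [IterDer.taylorHom, θ_t, PowerSeries.coeff_X]

/-- Since `t` expands to `f(t) + X`, which is transcendental, injectivity follows from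
`injective_of_transcendental`. It is used for an arbitrary target domain: the residue rings of
maximal ideals give ID-simplicity, and the point `(1, 0)` gives the embedding into `C⟦t⟧`. -/
lemma taylorHom_injective {L : Type v} [CommRing L] [IsDomain L] [Algebra C L]
    (f : RingS C →ₐ[C] L) : Function.Injective ((iterDer C).taylorHom f.toRingHom) := by
  let g : RingS C →ₐ[C] L⟦X⟧ :=
    { (iterDer C).taylorHom f.toRingHom with
      commutes' := fun c => by
        ext n
        change PowerSeries.coeff n (PowerSeries.mk fun n =>
          f ((iterDer C).θ n (algebraMap C (RingS C) c))) = _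
        rw [PowerSeries.coeff_mk, isIDExt C n c]
        rcases n with _ | n
        · simp [IterDer.trivial, PowerSeries.algebraMap_apply]
        · simp [IterDer.trivial, PowerSeries.algebraMap_apply] }
  refine injective_of_transcendental g ?_
  have : g (t C) = PowerSeries.C (f (t C)) + PowerSeries.X := taylorHom_t f.toRingHom
  rw [this]
  exact transcendental_C_add_X _

lemma taylor_eq_taylorHom : taylor C = (iterDer C).taylorHom (evalPoint C).toRingHom := rfl

lemma taylor_injective : Function.Injective (taylor C) := taylorHom_injective (evalPoint C)

lemma tSeries_eq : tSeries C = PowerSeries.X := by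
  rw [tSeries, algebraMap_eq, taylor_eq_taylorHom, taylorHom_t]
  have : (evalPoint C).toRingHom (t C) = 0 := lift_t _ _
  rw [this]
  simp

instance : IsDomain (RingS C) := taylor_injective.isDomain (taylor C)

/-- A proper ID-ideal lies in some maximal ideal `m`. All `θ⁽ⁿ⁾` of its elements stay in `m`, so
their Taylor expansions over `S / m` vanish, and these expansions are injective. -/
lemma isSimple : (iterDer C).IsSimple := by
  refine ⟨inferInstance, fun I hI => or_iff_not_imp_right.2 fun hne => ?_⟩
  obtain ⟨m, hm, hIm⟩ := Ideal.exists_le_maximal I hne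
  have := hm.isPrime
  rw [eq_bot_iff]
  intro x hx
  refine taylorHom_injective (Ideal.Quotient.mkₐ C m) ?_
  refine PowerSeries.ext fun n => ?_
  rw [IterDer.coeff_taylorHom, map_zero, map_zero]
  exact Ideal.Quotient.eq_zero_iff_mem.2 (hIm (hI n x hx))

/-- The Taylor expansion of a constant at the rational point `(1, 0)` is its value there, an element
of `C`; the expansion is injective. -/
lemma constants_eq : (iterDer C).constants = (algebraMap C (RingS C)).range := by
  ext x
  constructor
  · intro hx
    refine ⟨evalPoint C x, taylor_injective ?_⟩
    ext n
    rw [taylor_eq_taylorHom, IterDer.coeff_taylorHom, IterDer.coeff_taylorHom]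
    rcases Nat.eq_zero_or_pos n with rfl | hn
    · simp [IterDer.θ_zero]
    · rw [hx n hn, isIDExt C n]
      simp [IterDer.trivial, hn.ne']
  · rintro ⟨c, rfl⟩ n hn
    rw [isIDExt C n]
    simp [IterDer.trivial, hn.ne']

end Simple

/-! ### The obstruction at infinity to `k t / s` being a logarithmic derivative -/

section Wronskian

open Polynomial

variable {C : Type u} [Field C] [CharZero C]

/-- Multiplying the difference by its conjugate gives its norm evaluated at `s`. This element is
transcendental over `C`, because `t` is algebraic over `C(s)` and expands to the variable of `C⟦t⟧`.
-/
lemma pair_injective {p q p' q' : C[X]} (h : pair p q = pair p' q') : p = p' ∧ q = q' := by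
  have h1 : pair (p - p') (q - q') = 0 := by rw [← pair_sub, h, sub_self]
  have h2 : pair (p - p') (q - q') * pair (p - p') (-(q - q')) = pair (pairNorm (p - p') (q - q')) 0
      := by
    rw [pair_mul, pairNorm]; congr 1 <;> ring
  rw [h1, zero_mul, pair, map_zero, zero_mul, add_zero] at h2
  have h3 : pairNorm (p - p') (q - q') = 0 := by
    by_contra h0
    have hs : IsAlgebraic C (s C) := ⟨_, h0, h2.symm⟩
    have ht : IsAlgebraic C (t C) := by
      refine IsAlgebraic.of_pow (n := 2) two_pos ?_
      rw [t_sq]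
      exact (hs.pow 3).sub hs
    have := ht.algHom (IsScalarTower.toAlgHom C (RingS C) C⟦X⟧)
    rw [IsScalarTower.coe_toAlgHom'] at this
    change IsAlgebraic C (tSeries C) at this
    rw [tSeries_eq] at this
    refine transcendental_C_add_X (C := C) (0 : C) ?_
    simpa using this
  have := pairNorm_eq_zero h3
  exact ⟨sub_eq_zero.1 this.1, sub_eq_zero.1 this.2⟩

/-- Degrees at infinity: for non-zero `a, b ∈ S`, the logarithmic derivative of `a / b` is not
a non-zero multiple of `t / s`. -/
lemma wronskian_ne {a b : RingS C} (ha : a ≠ 0) (hb : b ≠ 0) {k : ℤ} (hk : k ≠ 0) :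
    s C * (b * der C a - a * der C b) ≠ k * t C * (a * b) := by
  intro h
  obtain ⟨n, p, q, hA⟩ := exists_pair_eq a
  obtain ⟨m, p', q', hB⟩ := exists_pair_eq b
  set d : RingS C := 3 * s C ^ 2 - 1 with hd
  have hd0 : d ≠ 0 := isUnit_disc.ne_zero
  -- multiply both elements by the same power of `d`
  wlog hnm : m = n generalizing n m p q p' q'
  · have hpow : ∀ j : ℕ, d ^ j = pair ((3 * X ^ 2 - 1) ^ j) 0 := fun j => by
      simp [pair, hd, map_ofNat (aeval (s C)) 3]
    exact this (m + n) _ _ (m + n) _ _ ((by rw [pow_add, mul_assoc, hA, hpow] :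
      d ^ (m + n) * a = _).trans (pair_mul _ _ _ _))
      ((by rw [pow_add, mul_comm (d ^ m), mul_assoc, hB, hpow] :
        d ^ (m + n) * b = _).trans (pair_mul _ _ _ _)) rfl
  subst hnm
  have hA0 : pair p q ≠ 0 := hA ▸ mul_ne_zero (pow_ne_zero _ hd0) ha
  have hB0 : pair p' q' ≠ 0 := hB ▸ mul_ne_zero (pow_ne_zero _ hd0) hb
  -- The relation is homogeneous in `(a, b)`: scaling both by `dᵐ` multiplies it by `d²ᵐ`, as the
  -- derivatives of `dᵐ` cancel. The additional factor `d` removes the denominators from the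
  -- derivatives.
  have h' : s C * (pair p' q' * (d * der C (pair p q)) - pair p q * (d * der C (pair p' q')))
      = k * t C * d * (pair p q * pair p' q') := by
    rw [← hA, ← hB]
    simp only [Derivation.leibniz, smul_eq_mul]
    linear_combination (d ^ m * d ^ m * d) * h
  rw [hd, disc_mul_der_pair, disc_mul_der_pair, pair_mul, pair_mul, pair_mul, pair_sub] at h'
  have hs : s C = pair X 0 := by simp [pair]
  have hk' : (k : RingS C) * t C * (3 * s C ^ 2 - 1) = pair 0 ((k : C[X]) * (3 * X ^ 2 - 1)) := by
    simp [pair, map_ofNat (aeval (s C)) 3]; ring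
  rw [hk', hs, pair_mul, pair_mul] at h'
  obtain ⟨h1, h2⟩ := pair_injective h'
  -- From here on only pole orders at infinity, that is, degrees of norms, are compared.
  have h3 := congrArg₂ pairNorm h1 h2
  rw [pairNorm_mul, pairNorm_mul, pairNorm_mul] at h3
  have nA : pairNorm p q ≠ 0 := fun h0 => hA0 (by
    obtain ⟨rfl, rfl⟩ := pairNorm_eq_zero h0
    simp [pair])
  have nB : pairNorm p' q' ≠ 0 := fun h0 => hB0 (by
    obtain ⟨rfl, rfl⟩ := pairNorm_eq_zero h0
    simp [pair])
  have bA := degree_pairNorm_der_le (degree_le_natDegree (p := pairNorm p q))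
  have bB := degree_pairNorm_der_le (degree_le_natDegree (p := pairNorm p' q'))
  set na := (pairNorm p q).natDegree with hna
  set nb := (pairNorm p' q').natDegree with hnb
  have b1 : (pairNorm (p' * (2 * derivative q * (X ^ 3 - X) + q * (3 * X ^ 2 - 1)) +
      q' * (2 * derivative p) * (X ^ 3 - X)) (p' * (2 * derivative p) +
      q' * (2 * derivative q * (X ^ 3 - X) + q * (3 * X ^ 2 - 1)))).degree
        ≤ (na + nb + 1 : ℕ) := by
    rw [pairNorm_mul]
    refine (degree_mul_le_of_le degree_le_natDegree bA).trans ?_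
    rw [← hnb]
    norm_cast
    omega
  have b2 : (pairNorm (p * (2 * derivative q' * (X ^ 3 - X) + q' * (3 * X ^ 2 - 1)) +
      q * (2 * derivative p') * (X ^ 3 - X)) (p * (2 * derivative p') +
      q * (2 * derivative q' * (X ^ 3 - X) + q' * (3 * X ^ 2 - 1)))).degree
        ≤ (na + nb + 1 : ℕ) := by
    rw [pairNorm_mul]
    refine (degree_mul_le_of_le degree_le_natDegree bB).trans ?_
    rw [← hna]
    norm_cast
  have b3 := degree_mul_le_of_le (p := pairNorm (X : C[X]) 0) (a := 2)
    (by simp [pairNorm]) (degree_pairNorm_sub_le b1 b2)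
  rw [h3, degree_mul, degree_mul, degree_eq_natDegree nA, degree_eq_natDegree nB, ← hna, ← hnb,
    degree_pairNorm] at b3
  have hkC : (k : C) ≠ 0 := by exact_mod_cast hk
  have hdeg : ((k : C[X]) * (3 * X ^ 2 - 1)).degree = 2 := by
    have : (k : C[X]) * (3 * X ^ 2 - 1)
        = Polynomial.C (3 * k : C) * X ^ 2 + Polynomial.C 0 * X + Polynomial.C (-k : C) := by
      simp [show (Polynomial.C 3 : C[X]) = 3 from rfl]; ring
    rw [this]
    exact degree_quadratic (mul_ne_zero three_ne_zero hkC)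
  rw [hdeg, degree_zero, two_nsmul, two_nsmul] at b3
  -- The factor `t (3s² - 1)` on the right has pole order `3 + 4 = 7`. The left side has order at
  -- most `2` from `s` and `na + nb + 1` from the Wronskian, so `7 ≤ 3` would follow.
  have b4 : ((2 : ℕ) + (2 : ℕ) + (3 : ℕ) + ((na : ℕ) + (nb : ℕ)) : WithBot ℕ)
      ≤ (2 : ℕ) + ((na + nb + 1 : ℕ) : WithBot ℕ) :=
    le_trans (by simp) b3
  norm_cast at b4
  omega

end Wronskian

end RingS

/-! ### The differential equation -/

section ODE

variable {C : Type u} [Field C]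

/-- The coefficients of the solution of `y' = g y` with constant coefficient `1`. -/
noncomputable def odeCoeff (g : C⟦X⟧) : ℕ → C
  | 0 => 1
  | n + 1 => ((n : C) + 1)⁻¹ * ∑ i : Fin (n + 1), PowerSeries.coeff (n - i) g * odeCoeff g i

variable [CharZero C]

lemma exists_derivative_eq_mul (g : C⟦X⟧) :
    ∃ y : C⟦X⟧, y ≠ 0 ∧ PowerSeries.derivative C y = g * y := by
  refine ⟨PowerSeries.mk (odeCoeff g), fun h => ?_, ?_⟩
  · have := congrArg (PowerSeries.coeff 0) h
    rw [PowerSeries.coeff_mk, odeCoeff, map_zero] at this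
    exact one_ne_zero this
  · ext n
    have hn : (n : C) + 1 ≠ 0 := by exact_mod_cast n.succ_ne_zero
    rw [PowerSeries.coeff_derivative, PowerSeries.coeff_mk, odeCoeff, mul_comm,
      mul_inv_cancel_left₀ hn, mul_comm g, PowerSeries.coeff_mul, Finset.Nat.sum_antidiagonal_eq_sum_range_succ
        (fun i j => PowerSeries.coeff i (PowerSeries.mk (odeCoeff g)) * PowerSeries.coeff j g),
      Finset.sum_range]
    exact Finset.sum_congr rfl fun i _ => by rw [PowerSeries.coeff_mk, mul_comm]

/-- The equation determines each coefficient from the preceding ones, so a solution with zero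
constant term vanishes. Consequently a non-zero solution is a unit, and `y⁻¹` in `C⟦X⟧` is a true
inverse rather than the default value `0`. -/
lemma constantCoeff_ne_zero_of_derivative_eq {g y : C⟦X⟧} (hy : y ≠ 0)
    (h : PowerSeries.derivative C y = g * y) : PowerSeries.constantCoeff y ≠ 0 := by
  intro h0
  refine hy (PowerSeries.ext fun n => ?_)
  induction n using Nat.strong_induction_on with
  | _ n ih =>
    rcases n with _ | n
    · simpa using h0
    · have h1 := congrArg (PowerSeries.coeff n) h
      have hn : (n : C) + 1 ≠ 0 := by exact_mod_cast n.succ_ne_zero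
      rw [PowerSeries.coeff_derivative, PowerSeries.coeff_mul, Finset.sum_eq_zero] at h1
      · simpa [hn] using h1
      · rintro ⟨i, j⟩ hij
        have : i + j = n := by simpa using hij
        rw [ih j (by omega), map_zero, mul_zero]

end ODE

namespace RingS

/-! ### Quot(S)-multiples of powers of z, and their independence -/

section Homogeneous

variable {C : Type u} [Field C] [CharZero C]

lemma algebraMap_injective : Function.Injective (algebraMap (RingS C) C⟦X⟧) := taylor_injective

lemma powerSeries_θ_one (x : C⟦X⟧) :
    (powerSeriesIterDer C).θ 1 x = PowerSeries.derivative C x := by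
  simp [powerSeriesIterDer, IterDer.ofDerivation, dividedPow_apply]

lemma derivative_algebraMap (x : RingS C) :
    PowerSeries.derivative C (algebraMap (RingS C) C⟦X⟧ x)
      = algebraMap (RingS C) C⟦X⟧ (der C x) := by
  rw [← powerSeries_θ_one, isIDExt_powerSeries, θ_one_eq]

lemma derivative_smul (a : RingS C) (x : C⟦X⟧) :
    PowerSeries.derivative C (a • x) = der C a • x + a • PowerSeries.derivative C x := by
  rw [Algebra.smul_def, Derivation.leibniz, smul_eq_mul, smul_eq_mul, derivative_algebraMap,
    Algebra.smul_def, Algebra.smul_def]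
  ring

lemma constantCoeff_sSeries : PowerSeries.constantCoeff (sSeries C) = 1 := by
  rw [← PowerSeries.coeff_zero_eq_constantCoeff_apply, sSeries, algebraMap_eq, taylor_eq_taylorHom,
    IterDer.coeff_taylorHom, IterDer.θ_zero]
  exact lift_s _ _

lemma sSeries_mul_inv : sSeries C * (sSeries C)⁻¹ = 1 :=
  PowerSeries.mul_inv_cancel _ (by rw [constantCoeff_sSeries]; exact one_ne_zero)

lemma sSeries_ne_zero : sSeries C ≠ 0 := left_ne_zero_of_mul_eq_one sSeries_mul_inv

lemma tSeries_sq : tSeries C ^ 2 = sSeries C ^ 3 - sSeries C := by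
  simpa [tSeries, sSeries] using congrArg (algebraMap (RingS C) C⟦X⟧) (t_sq C)

lemma series_disc_mul :
    (3 * sSeries C ^ 2 - 1) * algebraMap (RingS C) C⟦X⟧ (discInv C) = 1 := by
  simpa [sSeries, map_ofNat (algebraMap (RingS C) C⟦X⟧) 3] using
    congrArg (algebraMap (RingS C) C⟦X⟧) (disc_mul_discInv C)

lemma derivative_sSeries : PowerSeries.derivative C (sSeries C)
    = 2 * tSeries C * algebraMap (RingS C) C⟦X⟧ (discInv C) := by
  rw [sSeries, derivative_algebraMap, der_s]
  simp [tSeries, map_ofNat (algebraMap (RingS C) C⟦X⟧) 2]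

lemma derivative_tSeries : PowerSeries.derivative C (tSeries C) = 1 := by
  rw [tSeries, derivative_algebraMap, der_t, map_one]

instance : Module.IsTorsionFree (RingS C) C⟦X⟧ :=
  Module.isTorsionFree_iff_algebraMap_injective.2 algebraMap_injective

variable (z : C⟦X⟧ˣ)

/-- The `S`-module of the elements of `C⟦t⟧` that are multiples of `zⁿ` by elements of
`Quot(S)`. -/
def homog (n : ℤ) : Submodule (RingS C) C⟦X⟧ where
  carrier := {r | ∃ a b : RingS C, b ≠ 0 ∧ b • r = a • ((z ^ n : C⟦X⟧ˣ) : C⟦X⟧)}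
  zero_mem' := ⟨0, 1, one_ne_zero, by simp⟩
  add_mem' := by
    rintro x y ⟨a, b, hb, h⟩ ⟨a', b', hb', h'⟩
    refine ⟨b' * a + b * a', b * b', mul_ne_zero hb hb', ?_⟩
    rw [smul_add, mul_comm b b', mul_smul, h, mul_comm b' b, mul_smul, h', add_smul, mul_smul,
      mul_smul]
  smul_mem' := by
    rintro c x ⟨a, b, hb, h⟩
    exact ⟨c * a, b, hb, by rw [smul_comm, h, mul_smul]⟩

variable {z}

lemma smul_zpow_mem_homog (a : RingS C) (n : ℤ) :
    a • ((z ^ n : C⟦X⟧ˣ) : C⟦X⟧) ∈ homog z n := ⟨a, 1, one_ne_zero, by simp⟩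

lemma mul_mem_homog {m n : ℤ} {x y : C⟦X⟧} (hx : x ∈ homog z m) (hy : y ∈ homog z n) :
    x * y ∈ homog z (m + n) := by
  obtain ⟨a, b, hb, h⟩ := hx
  obtain ⟨a', b', hb', h'⟩ := hy
  refine ⟨a * a', b * b', mul_ne_zero hb hb', ?_⟩
  rw [← smul_mul_smul_comm, h, h', smul_mul_smul_comm, zpow_add, Units.val_mul]

lemma mem_homog_of_smul_mem {n : ℤ} {x : C⟦X⟧} {c : RingS C} (hc : c ≠ 0)
    (h : c • x ∈ homog z n) : x ∈ homog z n := by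
  obtain ⟨a, b, hb, h⟩ := h
  exact ⟨a, b * c, mul_ne_zero hb hc, by rw [mul_smul, h]⟩

lemma derivative_zpow (hz : sSeries C * PowerSeries.derivative C z = tSeries C * z) (n : ℤ) :
    s C • PowerSeries.derivative C ((z ^ n : C⟦X⟧ˣ) : C⟦X⟧)
      = ((n : RingS C) * t C) • ((z ^ n : C⟦X⟧ˣ) : C⟦X⟧) := by
  rw [Algebra.smul_def, Algebra.smul_def, map_mul, map_intCast]
  change sSeries C * _ = n * tSeries C * _
  have hinv : sSeries C * PowerSeries.derivative C ((z⁻¹ : C⟦X⟧ˣ) : C⟦X⟧)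
      = - (tSeries C * ((z⁻¹ : C⟦X⟧ˣ) : C⟦X⟧)) := by
    have h1 : (z : C⟦X⟧) * ((z⁻¹ : C⟦X⟧ˣ) : C⟦X⟧) = 1 := z.mul_inv
    have h2 := congrArg (PowerSeries.derivative C) h1
    rw [Derivation.leibniz, Derivation.map_one_eq_zero, smul_eq_mul, smul_eq_mul] at h2
    refine z.isUnit.mul_left_cancel ?_
    linear_combination sSeries C * h2 - ((z⁻¹ : C⟦X⟧ˣ) : C⟦X⟧) * hz
  induction n using Int.induction_on with
  | zero => simp
  | succ n ih =>
    rw [zpow_add_one, Units.val_mul, Derivation.leibniz, smul_eq_mul, smul_eq_mul]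
    push_cast at ih ⊢
    linear_combination (z : C⟦X⟧) * ih + ((z ^ (n : ℤ) : C⟦X⟧ˣ) : C⟦X⟧) * hz
  | pred n ih =>
    rw [zpow_sub_one, Units.val_mul, Derivation.leibniz, smul_eq_mul, smul_eq_mul]
    push_cast at ih ⊢
    linear_combination ((z⁻¹ : C⟦X⟧ˣ) : C⟦X⟧) * ih + ((z ^ (-n : ℤ) : C⟦X⟧ˣ) : C⟦X⟧) * hinv

lemma derivative_mem_homog (hz : sSeries C * PowerSeries.derivative C z = tSeries C * z) {n : ℤ}
    {x : C⟦X⟧} (hx : x ∈ homog z n) : PowerSeries.derivative C x ∈ homog z n := by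
  obtain ⟨a, b, hb, h⟩ := hx
  have hs : s C ≠ 0 := fun h0 => sSeries_ne_zero (C := C) (by rw [sSeries, h0, map_zero])
  -- Differentiating `b x = a zⁿ` leaves a term `∂(b) x` and a factor `t / s` from `∂(zⁿ)`. One
  -- factor `b` allows `b x` to be replaced by `a zⁿ`, and the factor `s` clears the denominator.
  refine mem_homog_of_smul_mem (c := s C * b * b) (mul_ne_zero (mul_ne_zero hs hb) hb) ?_
  have h1 := congrArg (PowerSeries.derivative C) h
  rw [derivative_smul, derivative_smul] at h1
  have h2 : (s C * b * b) • PowerSeries.derivative C x =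
      (s C * b * der C a + b * a * (n * t C) - s C * der C b * a) •
        ((z ^ n : C⟦X⟧ˣ) : C⟦X⟧) := by
    have h3 := derivative_zpow hz n
    simp only [Algebra.smul_def, map_mul, map_sub, map_add] at h h1 h3 ⊢
    linear_combination (algebraMap (RingS C) C⟦X⟧ (s C) * algebraMap (RingS C) C⟦X⟧ b) * h1 -
      (algebraMap (RingS C) C⟦X⟧ (s C) * algebraMap (RingS C) C⟦X⟧ (der C b)) * h +
      (algebraMap (RingS C) C⟦X⟧ b * algebraMap (RingS C) C⟦X⟧ a) * h3
  rw [h2]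
  exact smul_zpow_mem_homog _ _

/-- A non-trivial combination of powers of `z` in an `S`-submodule stable under the derivation
yields a monomial in this submodule. -/
lemma exists_smul_zpow_mem (hz : sSeries C * PowerSeries.derivative C z = tSeries C * z)
    (J : Submodule (RingS C) C⟦X⟧) (hJ : ∀ x ∈ J, PowerSeries.derivative C x ∈ J) (F : Finset ℤ)
    (hF : F.Nonempty) (a : ℤ → RingS C) (ha : ∀ n ∈ F, a n ≠ 0)
    (h : ∑ n ∈ F, a n • ((z ^ n : C⟦X⟧ˣ) : C⟦X⟧) ∈ J) :
    ∃ (n : ℤ) (b : RingS C), b ≠ 0 ∧ b • ((z ^ n : C⟦X⟧ˣ) : C⟦X⟧) ∈ J := by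
  induction F using Finset.induction_on generalizing a with
  | empty => exact absurd hF (by simp)
  | insert k F hk ih =>
    rcases F.eq_empty_or_nonempty with rfl | hF'
    · exact ⟨k, a k, ha k (by simp), by simpa using h⟩
    · have hak := ha k (by simp)
      -- These are the coefficients of `aₖ s ∂(r) - (s ∂(aₖ) + k t aₖ) r`, where `r` is the given
      -- combination. The term of index `k` disappears, and the others are non-zero by
      -- `wronskian_ne` applied with the integer `k - n`.
      refine ih hF' (fun n => s C * (a k * der C (a n) - a n * der C (a k))
        - ((k - n : ℤ) : RingS C) * t C * (a n * a k)) (fun n hn => ?_) ?_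
      · rw [sub_ne_zero]
        exact wronskian_ne (ha n (by simp [hn])) hak
          (sub_ne_zero.2 (by rintro rfl; exact hk hn))
      · set r := ∑ n ∈ insert k F, a n • ((z ^ n : C⟦X⟧ˣ) : C⟦X⟧) with hr
        have h1 : (a k * s C) • PowerSeries.derivative C r
            - (s C * der C (a k) + k * t C * a k) • r ∈ J :=
          J.sub_mem (J.smul_mem _ (hJ _ h)) (J.smul_mem _ h)
        convert h1 using 1
        have h2 : ∀ n, (a k * s C) • PowerSeries.derivative C (a n • ((z ^ n : C⟦X⟧ˣ) : C⟦X⟧))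
            - (s C * der C (a k) + k * t C * a k) • (a n • ((z ^ n : C⟦X⟧ˣ) : C⟦X⟧)) =
            (s C * (a k * der C (a n) - a n * der C (a k))
              - ((k - n : ℤ) : RingS C) * t C * (a n * a k)) • ((z ^ n : C⟦X⟧ˣ) : C⟦X⟧) := by
          intro n
          have h3 := derivative_zpow hz n
          rw [derivative_smul]
          simp only [Algebra.smul_def, map_mul, map_sub, map_add, map_intCast, Int.cast_sub]
            at h3 ⊢
          linear_combination (algebraMap (RingS C) C⟦X⟧ (a k) *
            algebraMap (RingS C) C⟦X⟧ (a n)) * h3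
        rw [hr, map_sum, Finset.smul_sum, Finset.smul_sum, ← Finset.sum_sub_distrib,
          Finset.sum_congr rfl (fun n _ => h2 n), Finset.sum_insert hk]
        simp [sub_self, mul_comm]

/-- Multiplication by the product of all denominators `b m` reduces to coefficients in `S`; this
stays inside `J` because `J` is an `S`-submodule. -/
lemma exists_smul_zpow_mem_of_homog
    (hz : sSeries C * PowerSeries.derivative C z = tSeries C * z)
    (J : Submodule (RingS C) C⟦X⟧) (hJ : ∀ x ∈ J, PowerSeries.derivative C x ∈ J) (F : Finset ℤ)
    (hF : F.Nonempty) (r : ℤ → C⟦X⟧) (hr : ∀ n ∈ F, r n ≠ 0) (hr' : ∀ n ∈ F, r n ∈ homog z n)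
    (h : ∑ n ∈ F, r n ∈ J) :
    ∃ (n : ℤ) (b : RingS C), b ≠ 0 ∧ b • ((z ^ n : C⟦X⟧ˣ) : C⟦X⟧) ∈ J := by
  choose! a b hb hab using hr'
  refine exists_smul_zpow_mem hz J hJ F hF (fun n => (∏ m ∈ F.erase n, b m) * a n) ?_ ?_
  · intro n hn
    refine mul_ne_zero (Finset.prod_ne_zero_iff.2 fun m hm => hb m (Finset.mem_of_mem_erase hm)) ?_
    intro h0
    have := hab n hn
    rw [h0, zero_smul, smul_eq_zero_iff_right (hb n hn)] at this
    exact hr n hn this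
  · have := J.smul_mem (∏ m ∈ F, b m) h
    rw [Finset.smul_sum] at this
    convert this using 1
    refine Finset.sum_congr rfl fun n hn => ?_
    rw [mul_smul, ← hab n hn, ← mul_smul, Finset.prod_erase_mul _ _ hn]

/-- The shortening argument is applied to the zero submodule: it would put a non-zero multiple of
the unit `zⁿ` in `⊥`. -/
lemma sum_homog_ne_zero (hz : sSeries C * PowerSeries.derivative C z = tSeries C * z)
    (F : Finset ℤ) (hF : F.Nonempty) (r : ℤ → C⟦X⟧) (hr : ∀ n ∈ F, r n ≠ 0)
    (hr' : ∀ n ∈ F, r n ∈ homog z n) : ∑ n ∈ F, r n ≠ 0 := by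
  intro h
  obtain ⟨n, b, hb, h⟩ := exists_smul_zpow_mem_of_homog hz ⊥ (by simp) F hF r hr hr' (by simpa)
  rw [Submodule.mem_bot, smul_eq_zero_iff_right hb] at h
  exact (z ^ n).ne_zero h

lemma pow_mem_homog {x : C⟦X⟧} (hx : x ∈ homog z 1) (n : ℕ) : x ^ n ∈ homog z n := by
  induction n with
  | zero =>
    rw [pow_zero]
    exact ⟨1, 1, one_ne_zero, by rw [Nat.cast_zero, zpow_zero, Units.val_one]⟩
  | succ n ih =>
    rw [pow_succ, Nat.cast_succ]
    exact mul_mem_homog ih hx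

/-- The monomials of `p(x)` lie in distinct degrees, so they cannot cancel. The case of degree 1
covers both `y = s z` and `y / s = z`. -/
lemma transcendental_of_mem_homog
    (hz : sSeries C * PowerSeries.derivative C z = tSeries C * z) {x : C⟦X⟧} (hx0 : x ≠ 0)
    (hx : x ∈ homog z 1) : Transcendental (RingS C) x := by
  rintro ⟨p, hp, h⟩
  rw [Polynomial.aeval_def, Polynomial.eval₂_eq_sum, Polynomial.sum] at h
  refine sum_homog_ne_zero hz (p.support.map Nat.castEmbedding) (by simpa using hp)
    (fun n => algebraMap (RingS C) C⟦X⟧ (p.coeff n.toNat) * x ^ n.toNat) ?_ ?_ ?_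
  · intro n hn
    obtain ⟨m, hm, rfl⟩ := Finset.mem_map.1 hn
    refine mul_ne_zero ?_ (pow_ne_zero _ hx0)
    rw [Ne, map_eq_zero_iff _ algebraMap_injective]
    simpa using hm
  · intro n hn
    obtain ⟨m, hm, rfl⟩ := Finset.mem_map.1 hn
    rw [← Algebra.smul_def]
    exact Submodule.smul_mem _ _ (by simpa using pow_mem_homog hx m)
  · rw [Finset.sum_map]
    simpa using h

lemma mul_pow_ne_of_mem_homog
    (hz : sSeries C * PowerSeries.derivative C z = tSeries C * z) {x : C⟦X⟧} (hx0 : x ≠ 0)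
    (hx : x ∈ homog z 1) {n : ℕ} (hn : 0 < n) (a : RingS C) {b : RingS C} (hb : b ≠ 0) :
    algebraMap (RingS C) C⟦X⟧ b * x ^ n ≠ algebraMap (RingS C) C⟦X⟧ a := by
  intro h
  refine transcendental_of_mem_homog hz hx0 hx
    ⟨Polynomial.C b * Polynomial.X ^ n - Polynomial.C a, fun h0 => hb ?_, by simp [h]⟩
  simpa [Polynomial.coeff_C, hn.ne'] using congrArg (fun p => Polynomial.coeff p n) h0

lemma eq_zero_of_sum_homog_eq_zero
    (hz : sSeries C * PowerSeries.derivative C z = tSeries C * z) (F : Finset ℤ) (r : ℤ → C⟦X⟧)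
    (hr : ∀ n ∈ F, r n ∈ homog z n) (h : ∑ n ∈ F, r n = 0) : ∀ n ∈ F, r n = 0 := by
  classical
  by_contra! hne
  obtain ⟨n, hn, hn0⟩ := hne
  refine sum_homog_ne_zero hz (F.filter fun n => r n ≠ 0) ⟨n, by simp [hn, hn0]⟩ r
    (fun m hm => (Finset.mem_filter.1 hm).2) (fun m hm => hr m (Finset.mem_filter.1 hm).1) ?_
  rwa [Finset.sum_filter_ne_zero]

end Homogeneous

end RingS

/-! ### The ring `S[y, y t / s, s / y, t / y]` -/

namespace RingS

section GenRing

variable {C : Type u} [Field C] [CharZero C]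

/-- A solution `y` of the equation is `s z` for a unit `z` with `s z' = t z`. -/
lemma IsSolution.exists_unit {y : C⟦X⟧} (hy : IsSolution (0 : RingS C) y) :
    ∃ z : C⟦X⟧ˣ, y = sSeries C * z ∧ y⁻¹ = (sSeries C)⁻¹ * ((z⁻¹ : C⟦X⟧ˣ) : C⟦X⟧) ∧
      sSeries C * PowerSeries.derivative C z = tSeries C * z := by
  obtain ⟨hy0, hy⟩ := hy
  have hc := constantCoeff_ne_zero_of_derivative_eq hy0 hy
  have hyi := PowerSeries.mul_inv_cancel y hc
  have hs := sSeries_mul_inv (C := C)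
  set Y := y⁻¹
  set σ := sSeries C
  set τ := (sSeries C)⁻¹
  have hz : (y * τ) * (σ * Y) = 1 := by linear_combination y * Y * hs + hyi
  refine ⟨⟨y * τ, σ * Y, hz, by rw [mul_comm]; exact hz⟩, ?_, ?_, ?_⟩
  · simp only
    linear_combination (-y) * hs
  · change Y = τ * (σ * Y)
    linear_combination (-Y) * hs
  · simp only
    have hd := series_disc_mul (C := C)
    have hdi : (3 * sSeries C ^ 2 - 1)⁻¹ = algebraMap (RingS C) C⟦X⟧ (discInv C) := by
      rw [eq_comm, PowerSeries.eq_inv_iff_mul_eq_one, mul_comm, hd]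
      rw [map_sub, map_mul, map_pow, constantCoeff_sSeries, map_one,
        map_ofNat (PowerSeries.constantCoeff (R := C)) 3]
      norm_num
    have hDs := derivative_sSeries (C := C)
    have hyz : y = σ * (y * τ) := by linear_combination (-y) * hs
    rw [hdi, map_zero, zero_add] at hy
    have h1 := congrArg (PowerSeries.derivative C) hyz
    rw [Derivation.leibniz, smul_eq_mul, smul_eq_mul, hDs, hy] at h1
    set δ := algebraMap (RingS C) C⟦X⟧ (discInv C)
    set T := tSeries C
    -- With `y = s z`, the term `2t / (3s² - 1)` coming from `∂(s)` is subtracted from `(3s² + 1) t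
    -- / (3s² - 1)`. What remains is `t`, whence `s ∂(z) = t z`.
    linear_combination (-1 : C⟦X⟧) * h1 + (y * τ * T) * hd

variable (z : C⟦X⟧ˣ)

/-- The ring `⊕ Iⁿ zⁿ`, for `I = (s, t)`. -/
noncomputable def genRing : Subalgebra (RingS C) C⟦X⟧ :=
  Algebra.adjoin (RingS C) {sSeries C * z, tSeries C * z, ((z⁻¹ : C⟦X⟧ˣ) : C⟦X⟧),
    tSeries C * (sSeries C)⁻¹ * ((z⁻¹ : C⟦X⟧ˣ) : C⟦X⟧)}

/-- In terms of `z` the four generators are `s z`, `t z`, `1 / z` and `t / (s z)`: two for `I z` and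
two for `I⁻¹ z⁻¹`. -/
lemma pvRing_eq {y : C⟦X⟧} (hy : y = sSeries C * z)
    (hyi : y⁻¹ = (sSeries C)⁻¹ * ((z⁻¹ : C⟦X⟧ˣ) : C⟦X⟧)) : pvRing y = genRing z := by
  have hs := sSeries_mul_inv (C := C)
  rw [pvRing, genRing, hyi, hy]
  congr 2
  · refine congrArg₂ _ ?_ (congrArg₂ _ ?_ (congrArg _ ?_))
    · linear_combination tSeries C * z * hs
    · linear_combination ((z⁻¹ : C⟦X⟧ˣ) : C⟦X⟧) * hs
    · ring

variable {z}

/-- The generator `s z`. -/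
noncomputable def genS (z : C⟦X⟧ˣ) : genRing z :=
  ⟨sSeries C * z, Algebra.subset_adjoin (by simp)⟩

/-- The generator `t z`. -/
noncomputable def genT (z : C⟦X⟧ˣ) : genRing z :=
  ⟨tSeries C * z, Algebra.subset_adjoin (by simp)⟩

/-- The generator `1 / z`. -/
noncomputable def genInv (z : C⟦X⟧ˣ) : genRing z :=
  ⟨((z⁻¹ : C⟦X⟧ˣ) : C⟦X⟧), Algebra.subset_adjoin (by simp)⟩

/-- The generator `t / (s z)`. -/
noncomputable def genQuot (z : C⟦X⟧ˣ) : genRing z :=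
  ⟨tSeries C * (sSeries C)⁻¹ * ((z⁻¹ : C⟦X⟧ˣ) : C⟦X⟧), Algebra.subset_adjoin (by simp)⟩

lemma genRing_induction {p : genRing z → Prop} (hS : ∀ a, p (algebraMap (RingS C) _ a))
    (h1 : p (genS z)) (h2 : p (genT z)) (h3 : p (genInv z)) (h4 : p (genQuot z))
    (hadd : ∀ x y, p x → p y → p (x + y)) (hmul : ∀ x y, p x → p y → p (x * y)) (x : genRing z) :
    p x := by
  obtain ⟨x, hx⟩ := x
  refine Algebra.adjoin_induction (p := fun x hx => p ⟨x, hx⟩) ?_ hS ?_ ?_ hx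
  · rintro x (rfl | rfl | rfl | rfl)
    exacts [h1, h2, h3, h4]
  · exact fun x y hx hy hpx hpy => hadd _ _ hpx hpy
  · exact fun x y hx hy hpx hpy => hmul _ _ hpx hpy

/-- The pair `(s z, t z)` satisfies the two defining relations of `M`, and so does `(1 / z, t / (s
z))`, being proportional to it. The products of the two pairs computed further on all lie in `S`. -/
lemma s_smul_genT : s C • genT z = t C • genS z :=
  Subtype.ext <| by
    change s C • (tSeries C * (z : C⟦X⟧)) = t C • (sSeries C * (z : C⟦X⟧))
    rw [Algebra.smul_def, Algebra.smul_def]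
    change sSeries C * _ = tSeries C * _
    ring

lemma t_smul_genT : t C • genT z = (s C ^ 2 - 1) • genS z :=
  Subtype.ext <| by
    change t C • (tSeries C * (z : C⟦X⟧)) = (s C ^ 2 - 1) • (sSeries C * (z : C⟦X⟧))
    rw [Algebra.smul_def, Algebra.smul_def, map_sub, map_pow, map_one]
    change tSeries C * _ = (sSeries C ^ 2 - 1) * _
    linear_combination (z : C⟦X⟧) * tSeries_sq (C := C)

lemma s_smul_genQuot : s C • genQuot z = t C • genInv z :=
  Subtype.ext <| by
    change s C • (tSeries C * (sSeries C)⁻¹ * ((z⁻¹ : C⟦X⟧ˣ) : C⟦X⟧))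
      = t C • ((z⁻¹ : C⟦X⟧ˣ) : C⟦X⟧)
    rw [Algebra.smul_def, Algebra.smul_def]
    change sSeries C * _ = tSeries C * _
    linear_combination tSeries C * ((z⁻¹ : C⟦X⟧ˣ) : C⟦X⟧) * sSeries_mul_inv (C := C)

lemma t_smul_genQuot : t C • genQuot z = (s C ^ 2 - 1) • genInv z :=
  Subtype.ext <| by
    change t C • (tSeries C * (sSeries C)⁻¹ * ((z⁻¹ : C⟦X⟧ˣ) : C⟦X⟧))
      = (s C ^ 2 - 1) • ((z⁻¹ : C⟦X⟧ˣ) : C⟦X⟧)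
    rw [Algebra.smul_def, Algebra.smul_def, map_sub, map_pow, map_one]
    change tSeries C * _ = (sSeries C ^ 2 - 1) * _
    linear_combination (sSeries C)⁻¹ * ((z⁻¹ : C⟦X⟧ˣ) : C⟦X⟧) * tSeries_sq (C := C) +
      (sSeries C ^ 2 - 1) * ((z⁻¹ : C⟦X⟧ˣ) : C⟦X⟧) * sSeries_mul_inv (C := C)

lemma genS_mul_genInv : genS z * genInv z = algebraMap (RingS C) _ (s C) :=
  Subtype.ext <| by
    change sSeries C * (z : C⟦X⟧) * ((z⁻¹ : C⟦X⟧ˣ) : C⟦X⟧) = sSeries C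
    rw [mul_assoc, z.mul_inv, mul_one]

lemma genT_mul_genInv : genT z * genInv z = algebraMap (RingS C) _ (t C) :=
  Subtype.ext <| by
    change tSeries C * (z : C⟦X⟧) * ((z⁻¹ : C⟦X⟧ˣ) : C⟦X⟧) = tSeries C
    rw [mul_assoc, z.mul_inv, mul_one]

lemma genS_mul_genQuot : genS z * genQuot z = algebraMap (RingS C) _ (t C) :=
  Subtype.ext <| by
    change sSeries C * (z : C⟦X⟧) * (tSeries C * (sSeries C)⁻¹ * ((z⁻¹ : C⟦X⟧ˣ) : C⟦X⟧))
      = tSeries C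
    linear_combination tSeries C * z.mul_inv +
      tSeries C * z * ((z⁻¹ : C⟦X⟧ˣ) : C⟦X⟧) * sSeries_mul_inv (C := C)

lemma genT_mul_genQuot : genT z * genQuot z = algebraMap (RingS C) _ (s C ^ 2 - 1) :=
  Subtype.ext <| by
    change tSeries C * (z : C⟦X⟧) * (tSeries C * (sSeries C)⁻¹ * ((z⁻¹ : C⟦X⟧ˣ) : C⟦X⟧))
      = algebraMap (RingS C) C⟦X⟧ (s C ^ 2 - 1)
    rw [map_sub, map_pow, map_one]
    change _ = sSeries C ^ 2 - 1
    linear_combination (sSeries C)⁻¹ * tSeries_sq (C := C) +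
      (sSeries C ^ 2 - 1) * sSeries_mul_inv (C := C) +
      tSeries C ^ 2 * (sSeries C)⁻¹ * z.mul_inv

/-- This is `I · I⁻¹ = S` made explicit: `s · s - (t / s) · t = s² - (s² - 1)`. Every later step
that recovers an element from its products with `s z` and `t z` uses it. -/
lemma genRing_partition : (s C • genInv z) * genS z - genQuot z * genT z = 1 := by
  rw [smul_mul_assoc, mul_comm, genS_mul_genInv, mul_comm, genT_mul_genQuot, Algebra.smul_def,
    ← map_mul, ← map_sub, ← map_one (algebraMap (RingS C) (genRing z))]
  congr 1
  ring

lemma θ_mem_of_derivative_mem {A : Type*} [SetLike A C⟦X⟧] (N : A)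
    (hN : ∀ (c : C), ∀ x ∈ N, c • x ∈ N) (hN' : ∀ x ∈ N, PowerSeries.derivative C x ∈ N) (n : ℕ)
    {x : C⟦X⟧} (hx : x ∈ N) : (powerSeriesIterDer C).θ n x ∈ N := by
  refine hN _ _ ?_
  induction n with
  | zero => simpa
  | succ n ih =>
    rw [pow_succ', Module.End.mul_apply]
    exact hN' _ ih

/-! ### The derivation on the generators -/

section Der

variable (hz : sSeries C * PowerSeries.derivative C z = tSeries C * z)
include hz

lemma derivative_genS : PowerSeries.derivative C (genS z : C⟦X⟧)
    = ((((3 * s C ^ 2 + 1) * discInv C) • genT z : genRing z) : C⟦X⟧) := by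
  change PowerSeries.derivative C (sSeries C * (z : C⟦X⟧))
    = ((3 * s C ^ 2 + 1) * discInv C) • (tSeries C * (z : C⟦X⟧))
  rw [Algebra.smul_def, Derivation.leibniz, derivative_sSeries, smul_eq_mul, smul_eq_mul, hz]
  simp only [map_mul, map_add, map_pow, map_one, map_ofNat]
  change _ = (3 * sSeries C ^ 2 + 1) * _ * _
  linear_combination (-(tSeries C * (z : C⟦X⟧))) * series_disc_mul (C := C)

lemma derivative_genT : PowerSeries.derivative C (genT z : C⟦X⟧)
    = ((s C • genS z : genRing z) : C⟦X⟧) := by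
  change PowerSeries.derivative C (tSeries C * (z : C⟦X⟧)) = s C • (sSeries C * (z : C⟦X⟧))
  rw [Algebra.smul_def, Derivation.leibniz, derivative_tSeries, smul_eq_mul, smul_eq_mul]
  change _ = sSeries C * _
  refine mul_left_cancel₀ (sSeries_ne_zero (C := C)) ?_
  linear_combination tSeries C * hz + (z : C⟦X⟧) * tSeries_sq (C := C)

lemma derivative_genInv : PowerSeries.derivative C (genInv z : C⟦X⟧)
    = ((-genQuot z : genRing z) : C⟦X⟧) := by
  change PowerSeries.derivative C ((z⁻¹ : C⟦X⟧ˣ) : C⟦X⟧)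
    = -(tSeries C * (sSeries C)⁻¹ * ((z⁻¹ : C⟦X⟧ˣ) : C⟦X⟧))
  have h := derivative_zpow hz (-1)
  rw [zpow_neg_one, Algebra.smul_def, Algebra.smul_def, map_mul, map_intCast] at h
  change sSeries C * _ = _ * tSeries C * _ at h
  refine mul_left_cancel₀ (sSeries_ne_zero (C := C)) ?_
  push_cast at h
  linear_combination h + tSeries C * ((z⁻¹ : C⟦X⟧ˣ) : C⟦X⟧) * sSeries_mul_inv (C := C)

/-- The relation `s q = t p` with `p = 1 / z`, `q = t / (s z)` is differentiated, using `∂(p) = -q`;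
the remaining products `t q` are rewritten as `(s² - 1) p`. -/
lemma derivative_genQuot : PowerSeries.derivative C (genQuot z : C⟦X⟧)
    = (((s C * (5 - 3 * s C ^ 2) * discInv C) • genInv z : genRing z) : C⟦X⟧) := by
  have h := congrArg (fun x : genRing z => PowerSeries.derivative C (x : C⟦X⟧))
    (s_smul_genQuot (z := z))
  change PowerSeries.derivative C (s C • (genQuot z : C⟦X⟧))
    = PowerSeries.derivative C (t C • (genInv z : C⟦X⟧)) at h
  have h1 := congrArg (fun x : genRing z => (x : C⟦X⟧)) (s_smul_genQuot (z := z))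
  have h2 := congrArg (fun x : genRing z => (x : C⟦X⟧)) (t_smul_genQuot (z := z))
  change s C • (genQuot z : C⟦X⟧) = t C • (genInv z : C⟦X⟧) at h1
  change t C • (genQuot z : C⟦X⟧) = (s C ^ 2 - 1) • (genInv z : C⟦X⟧) at h2
  rw [derivative_smul, derivative_smul, der_s, der_t, one_smul, derivative_genInv hz] at h
  change _ = _ + t C • -(genQuot z : C⟦X⟧) at h
  change _ = (s C * (5 - 3 * s C ^ 2) * discInv C) • (genInv z : C⟦X⟧)
  set q := (genQuot z : C⟦X⟧)
  set p := (genInv z : C⟦X⟧)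
  have hd := series_disc_mul (C := C)
  refine mul_left_cancel₀ (sSeries_ne_zero (C := C)) ?_
  simp only [Algebra.smul_def, map_mul, map_sub, map_pow, map_one, map_ofNat] at h h1 h2 ⊢
  change sSeries C * q = tSeries C * p at h1
  change tSeries C * q = (sSeries C ^ 2 - 1) * p at h2
  change 2 * tSeries C * _ * q + sSeries C * _ = p + tSeries C * -q at h
  change sSeries C * _ = sSeries C * (sSeries C * (5 - 3 * sSeries C ^ 2) * _ * p)
  set δ := algebraMap (RingS C) C⟦X⟧ (discInv C)
  linear_combination h - (2 * δ + 1) * h2 + (sSeries C ^ 2 - 2) * p * hd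

lemma derivative_mem_genRing {x : C⟦X⟧} (hx : x ∈ genRing z) :
    PowerSeries.derivative C x ∈ genRing z := by
  refine genRing_induction (p := fun x => PowerSeries.derivative C (x : C⟦X⟧) ∈ genRing z)
    (fun a => ?_) ?_ ?_ ?_ ?_ (fun x y hx hy => ?_) (fun x y hx hy => ?_) ⟨x, hx⟩
  · change PowerSeries.derivative C (algebraMap (RingS C) C⟦X⟧ a) ∈ genRing z
    rw [derivative_algebraMap]
    exact (genRing z).algebraMap_mem _
  · rw [derivative_genS hz]; exact Subtype.prop _
  · rw [derivative_genT hz]; exact Subtype.prop _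
  · rw [derivative_genInv hz]; exact Subtype.prop _
  · rw [derivative_genQuot hz]; exact Subtype.prop _
  · rw [Subalgebra.coe_add, map_add]
    exact add_mem hx hy
  · rw [Subalgebra.coe_mul, Derivation.leibniz]
    exact add_mem (mul_mem x.2 hy) (mul_mem y.2 hx)

lemma θ_mem_genRing (n : ℕ) (x : C⟦X⟧) (hx : x ∈ genRing z) :
    (powerSeriesIterDer C).θ n x ∈ genRing z :=
  θ_mem_of_derivative_mem (genRing z)
    (fun c x hx => by
      rw [← algebraMap_smul (RingS C) c x]
      exact (genRing z).smul_mem hx _)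
    (fun _ hx => derivative_mem_genRing hz hx) n hx

end Der

end GenRing

end RingS

/-! ### The grading, simplicity and constants -/

namespace RingS

section Grading

variable {C : Type u} [Field C] [CharZero C] (z : C⟦X⟧ˣ)

/-- The homogeneous part of degree `n` of `⊕ Iⁿ zⁿ`. -/
noncomputable def grade (n : ℤ) : Submodule C (genRing z) :=
  ((homog z n).restrictScalars C).comap ((genRing z).val.toLinearMap.restrictScalars C)

variable {z}

lemma mem_grade {n : ℤ} {x : genRing z} : x ∈ grade z n ↔ (x : C⟦X⟧) ∈ homog z n := Iff.rfl

lemma algebraMap_mem_grade (a : RingS C) : algebraMap (RingS C) (genRing z) a ∈ grade z 0 :=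
  ⟨a, 1, one_ne_zero, by
    rw [zpow_zero, Units.val_one, one_smul, Algebra.smul_def, mul_one]; rfl⟩

lemma genS_mem_grade : genS z ∈ grade z 1 :=
  ⟨s C, 1, one_ne_zero, by rw [zpow_one, one_smul, Algebra.smul_def]; rfl⟩

lemma genT_mem_grade : genT z ∈ grade z 1 :=
  ⟨t C, 1, one_ne_zero, by rw [zpow_one, one_smul, Algebra.smul_def]; rfl⟩

lemma genInv_mem_grade : genInv z ∈ grade z (-1) :=
  ⟨1, 1, one_ne_zero, by rw [zpow_neg_one]; rfl⟩

lemma s_ne_zero : s C ≠ 0 := fun h0 => sSeries_ne_zero (C := C) (by rw [sSeries, h0, map_zero])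

lemma genQuot_mem_grade : genQuot z ∈ grade z (-1) :=
  ⟨t C, s C, s_ne_zero, by
    rw [zpow_neg_one]
    exact congrArg (fun x : genRing z => (x : C⟦X⟧)) (s_smul_genQuot (z := z))⟩

instance : SetLike.GradedMonoid (grade z) where
  one_mem := by
    have := algebraMap_mem_grade (z := z) 1
    rwa [map_one] at this
  mul_mem _ _ _ _ hx hy := mul_mem_homog hx hy

/-- The sum is direct by the independence of the powers of `z`. It is everything because the sums of
homogeneous elements form a subring containing `S` and the four homogeneous generators. -/
lemma isInternal_grade (hz : sSeries C * PowerSeries.derivative C z = tSeries C * z) :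
    DirectSum.IsInternal (grade z) := by
  classical
  constructor
  · let _ : AddCommGroup (DirectSum ℤ fun i => grade z i) := Module.addCommMonoidToAddCommGroup C
    rw [injective_iff_map_eq_zero]
    intro d hd
    rw [DirectSum.coeAddMonoidHom_eq_dfinsuppSum, DFinsupp.sum] at hd
    have h := congrArg (genRing z).val hd
    rw [map_sum, map_zero] at h
    have h1 := eq_zero_of_sum_homog_eq_zero hz _ (fun i => ((d i : genRing z) : C⟦X⟧))
      (fun i _ => mem_grade.1 (d i).2) h
    refine DFinsupp.ext fun i => ?_
    by_cases hi : i ∈ DFinsupp.support d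
    · exact Subtype.ext (Subtype.ext (h1 i hi))
    · exact DFinsupp.notMem_support_iff.1 hi
  · have key : ∀ {n : ℤ} {x : genRing z}, x ∈ grade z n →
        ∃ d, DirectSum.coeRingHom (grade z) d = x :=
      fun {n x} hx => ⟨DirectSum.of _ n ⟨x, hx⟩, DirectSum.coeRingHom_of _ _ _⟩
    intro x
    change ∃ d, DirectSum.coeRingHom (grade z) d = x
    refine genRing_induction (p := fun x => ∃ d, DirectSum.coeRingHom (grade z) d = x)
      (fun a => key (algebraMap_mem_grade a)) (key genS_mem_grade) (key genT_mem_grade)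
      (key genInv_mem_grade) (key genQuot_mem_grade) ?_ ?_ x
    · rintro _ _ ⟨d, rfl⟩ ⟨e, rfl⟩
      exact ⟨d + e, map_add _ _ _⟩
    · rintro _ _ ⟨d, rfl⟩ ⟨e, rfl⟩
      exact ⟨d * e, map_mul _ _ _⟩

/-- The grading of `⊕ Iⁿ zⁿ`. -/
noncomputable abbrev gradedAlgebra
    (hz : sSeries C * PowerSeries.derivative C z = tSeries C * z) : GradedAlgebra (grade z) :=
  { (inferInstance : SetLike.GradedMonoid (grade z)),
    (isInternal_grade hz).chooseDecomposition with }

/-- The iterative derivation of `⊕ Iⁿ zⁿ`. -/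
noncomputable abbrev genIterDer
    (hz : sSeries C * PowerSeries.derivative C z = tSeries C * z) : IterDer (genRing z) :=
  (powerSeriesIterDer C).restrict (genRing z) (θ_mem_genRing hz)

/-- The image in `C⟦t⟧` of a non-zero ID-ideal contains some `b zⁿ` with `b ≠ 0`. Multiplying by an
element of degree `-n` produces a non-zero element of `S` in the ideal, and the ID-simplicity of `S`
then gives `1`. -/
lemma isSimple_genRing (hz : sSeries C * PowerSeries.derivative C z = tSeries C * z) :
    (genIterDer hz).IsSimple := by
  classical
  refine ⟨inferInstance, fun I hI => or_iff_not_imp_left.2 fun hne => ?_⟩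
  obtain ⟨x, hxI, hx0⟩ := Submodule.exists_mem_ne_zero_of_ne_bot hne
  let J : Submodule (RingS C) C⟦X⟧ :=
    (I.restrictScalars (RingS C)).map (genRing z).val.toLinearMap
  have hJ : ∀ x ∈ J, PowerSeries.derivative C x ∈ J := by
    rintro _ ⟨x, hx, rfl⟩
    refine ⟨(genIterDer hz).θ 1 x, hI 1 x hx, ?_⟩
    rw [← powerSeries_θ_one]
    rfl
  obtain ⟨d, hd⟩ := (isInternal_grade hz).2 x
  have hF : (DFinsupp.support d).Nonempty := by
    rw [Finset.nonempty_iff_ne_empty, Ne, DFinsupp.support_eq_empty]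
    rintro rfl
    exact hx0 (by rw [← hd, map_zero])
  rw [DirectSum.coeAddMonoidHom_eq_dfinsuppSum, DFinsupp.sum] at hd
  obtain ⟨n, b, hb, w, hwI, hw⟩ := exists_smul_zpow_mem_of_homog hz J hJ (DFinsupp.support d) hF
    (fun i => ((d i : genRing z) : C⟦X⟧))
    (fun i hi h0 => (DFinsupp.mem_support_iff.1 hi) (Subtype.ext (Subtype.ext h0)))
    (fun i _ => mem_grade.1 (d i).2)
    ⟨x, hxI, by rw [← hd]; exact map_sum _ _ _⟩
  have hS : ∃ c : RingS C, c ≠ 0 ∧ algebraMap (RingS C) (genRing z) c ∈ I := by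
    have hw' : (w : C⟦X⟧) = algebraMap (RingS C) C⟦X⟧ b * ((z ^ n : C⟦X⟧ˣ) : C⟦X⟧) := by
      rw [← Algebra.smul_def]
      exact hw
    obtain ⟨m, rfl | rfl⟩ := n.eq_nat_or_neg
    · refine ⟨b, hb, ?_⟩
      have h1 : algebraMap (RingS C) (genRing z) b = genInv z ^ m * w := by
        refine Subtype.ext ?_
        change algebraMap (RingS C) C⟦X⟧ b = ((z⁻¹ : C⟦X⟧ˣ) : C⟦X⟧) ^ m * (w : C⟦X⟧)
        rw [hw', zpow_natCast, mul_left_comm, ← Units.val_pow_eq_pow_val, ← Units.val_mul, inv_pow,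
          inv_mul_cancel, Units.val_one, mul_one]
      rw [h1]
      exact I.mul_mem_left _ hwI
    -- The factor of positive degree is `(s z)ᵐ`, a power of a generator of the ring; it costs the
    -- factor `sᵐ`.
    · refine ⟨b * s C ^ m, mul_ne_zero hb (pow_ne_zero _ s_ne_zero), ?_⟩
      have h1 : algebraMap (RingS C) (genRing z) (b * s C ^ m) = genS z ^ m * w := by
        refine Subtype.ext ?_
        change algebraMap (RingS C) C⟦X⟧ (b * s C ^ m)
          = (sSeries C * (z : C⟦X⟧)) ^ m * (w : C⟦X⟧)
        rw [hw', zpow_neg, zpow_natCast, mul_pow, mul_mul_mul_comm, ← Units.val_pow_eq_pow_val,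
          ← Units.val_mul, mul_inv_cancel, Units.val_one, mul_one, map_mul, map_pow, mul_comm]
        rfl
      rw [h1]
      exact I.mul_mem_left _ hwI
  obtain ⟨c, hc, hcI⟩ := hS
  rcases (isSimple (C := C)).2 (I.comap (algebraMap (RingS C) (genRing z))) (fun n a ha => by
    rw [Ideal.mem_comap] at ha ⊢
    have := hI n _ ha
    rwa [(isIDExt_powerSeries C).restrict (genRing z) (θ_mem_genRing hz) n a] at this) with h | h
  · have : c ∈ I.comap (algebraMap (RingS C) (genRing z)) := hcI
    rw [h] at this
    exact absurd this hc
  · rw [Ideal.eq_top_iff_one] at h ⊢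
    simpa using h

lemma eq_algebraMap_of_derivative_eq_zero {x : genRing z}
    (hx : PowerSeries.derivative C (x : C⟦X⟧) = 0) : ∃ c : C, x = algebraMap C (genRing z) c := by
  refine ⟨PowerSeries.constantCoeff (x : C⟦X⟧), Subtype.ext ?_⟩
  change (x : C⟦X⟧) = algebraMap C C⟦X⟧ _
  refine PowerSeries.derivative.ext (R := C) ?_ ?_
  · rw [hx, Derivation.map_algebraMap]
  · simp

lemma algebraMap_mem_constants (hz : sSeries C * PowerSeries.derivative C z = tSeries C * z)
    (c : C) : algebraMap C (genRing z) c ∈ (genIterDer hz).constants := fun n hn => by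
  have := (isIDExt C).comp ((isIDExt_powerSeries C).restrict (genRing z) (θ_mem_genRing hz)) n c
  rw [this]
  simp [IterDer.trivial, hn.ne']

lemma eq_algebraMap_of_mem_constants
    (hz : sSeries C * PowerSeries.derivative C z = tSeries C * z) {x : genRing z}
    (hx : x ∈ (genIterDer hz).constants) : ∃ c : C, x = algebraMap C (genRing z) c := by
  refine eq_algebraMap_of_derivative_eq_zero ?_
  rw [← powerSeries_θ_one]
  exact congrArg (fun x : genRing z => (x : C⟦X⟧)) (hx 1 one_pos)

lemma constants_genRing (hz : sSeries C * PowerSeries.derivative C z = tSeries C * z) :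
    (genIterDer hz).constants
      = (iterDer C).constants.map (algebraMap (RingS C) (genRing z)) := by
  ext x
  rw [constants_eq]
  constructor
  · intro hx
    obtain ⟨c, rfl⟩ := eq_algebraMap_of_mem_constants hz hx
    exact ⟨_, ⟨c, rfl⟩, (IsScalarTower.algebraMap_apply C (RingS C) (genRing z) c).symm⟩
  · rintro ⟨_, ⟨c, rfl⟩, rfl⟩
    have := algebraMap_mem_constants hz c
    rwa [IsScalarTower.algebraMap_apply C (RingS C) (genRing z)] at this

end Grading

end RingS

/-! ### The Picard-Vessiot property -/

section Solution

variable {S : Type u} [CommRing S] {dS : IterDer S} {M : Type w} [AddCommGroup M] [Module S M]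
  (dM : IterDerModule dS M) {R : Type v} [CommRing R] [Algebra S R] {dR : IterDer R}

lemma liftMap_smul {R' : Type*} [CommRing R'] [Algebra S R'] (g : R' →ₐ[S] R) (f : M →ₗ[S] R)
    (r : R') (x : R' ⊗[S] M) :
    (LinearMap.mul' S R ∘ₗ TensorProduct.map g.toLinearMap f) (r • x)
      = g r * (LinearMap.mul' S R ∘ₗ TensorProduct.map g.toLinearMap f) x := by
  induction x with
  | zero => simp
  | add a b ha hb => rw [smul_add, map_add, map_add, ha, hb, mul_add]
  | tmul r m => simp [TensorProduct.smul_tmul', mul_assoc]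

/-- A linear map `M → R` commuting with the iterative derivations extends to `R' ⊗ M → R`
for every homomorphism `R' → R` of ID-rings. -/
lemma liftMap_baseChangeTheta {R' : Type*} [CommRing R'] [Algebra S R'] {dR' : IterDer R'}
    (h : IsIDExt dS dR') (g : R' →ₐ[S] R) (hg : ∀ n x, g (dR'.θ n x) = dR.θ n (g x))
    (f : M →ₗ[S] R) (hf : ∀ n m, f (dM.θ n m) = dR.θ n (f m)) (n : ℕ) (x : R' ⊗[S] M) :
    (LinearMap.mul' S R ∘ₗ TensorProduct.map g.toLinearMap f) (baseChangeTheta dM h n x)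
      = dR.θ n ((LinearMap.mul' S R ∘ₗ TensorProduct.map g.toLinearMap f) x) := by
  induction x with
  | zero => simp
  | add a b ha hb => simp only [map_add, ha, hb]
  | tmul r m =>
    simp only [baseChangeTheta, tensorTheta_tmul, map_sum, LinearMap.comp_apply,
      TensorProduct.map_tmul, LinearMap.mul'_apply, AlgHom.toLinearMap_apply, hg, hf, dR.θ_mul]

/-- If `R ⊗ M ≅ R` as ID-modules, then `R` is a solution ring for `M`. -/
lemma isSolutionRing_of_bijective [Nontrivial R] (h : IsIDExt dS dR)
    (f : M →ₗ[S] R) (hf : ∀ n m, f (dM.θ n m) = dR.θ n (f m))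
    (hb : Function.Bijective (f.liftBaseChange R)) : IsSolutionRing dM dR := by
  refine ⟨inferInstance, h, ?_⟩
  have hθ : ∀ n x, f.liftBaseChange R (baseChangeTheta dM h n x)
      = dR.θ n (f.liftBaseChange R x) := by
    intro n x
    have key : ∀ x, f.liftBaseChange R x
        = (LinearMap.mul' S R ∘ₗ TensorProduct.map (AlgHom.id S R).toLinearMap f) x := by
      intro x
      induction x with
      | zero => simp
      | add a b ha hb => simp only [map_add, ha, hb]
      | tmul r m => simp
    rw [key, key]
    exact liftMap_baseChangeTheta dM h (AlgHom.id S R) (fun _ _ => rfl) f hf n x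
  have hmem : ∀ x, x ∈ baseChangeConstants dM h ↔ f.liftBaseChange R x ∈ dR.constants := by
    intro x
    refine forall₂_congr fun n hn => ?_
    rw [← hθ, map_eq_zero_iff _ hb.1]
  -- The preimage `u` of `1` is a constant, and the isomorphism with `R` identifies the constants of
  -- `R ⊗ M` with `C_R u`. So the source of `solutionMap` is `R ⊗ u`.
  obtain ⟨u, hu⟩ := hb.2 1
  have huc : u ∈ baseChangeConstants dM h := by
    rw [hmem, hu]
    exact one_mem _
  have hsol : ∀ x, ∃ r : R, x = r ⊗ₜ[dR.constants] (⟨u, huc⟩ : baseChangeConstants dM h) := by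
    intro x
    induction x with
    | zero => exact ⟨0, by simp⟩
    | add a b ha hb =>
      obtain ⟨r, rfl⟩ := ha
      obtain ⟨r', rfl⟩ := hb
      exact ⟨r + r', (TensorProduct.add_tmul _ _ _).symm⟩
    | tmul r v =>
      have hv : v = (⟨_, (hmem v).1 v.2⟩ : dR.constants) •
          (⟨u, huc⟩ : baseChangeConstants dM h) := by
        refine Subtype.ext (hb.1 ?_)
        change f.liftBaseChange R v = f.liftBaseChange R (f.liftBaseChange R (v : R ⊗[S] M) • u)
        rw [map_smul, hu, smul_eq_mul, mul_one]
      generalize (⟨_, (hmem v).1 v.2⟩ : dR.constants) = c at hv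
      exact ⟨c • r, by rw [hv, TensorProduct.tmul_smul, TensorProduct.smul_tmul']⟩
  have hval : ∀ r : R, f.liftBaseChange R (solutionMap dM h
      (r ⊗ₜ[dR.constants] (⟨u, huc⟩ : baseChangeConstants dM h))) = r := by
    intro r
    simp only [solutionMap, LinearMap.liftBaseChange_tmul, Submodule.subtype_apply, map_smul, hu,
      smul_eq_mul, mul_one]
  constructor
  · intro x y hxy
    obtain ⟨r, rfl⟩ := hsol x
    obtain ⟨r', rfl⟩ := hsol y
    rw [← hval r, hxy, hval r']
  · intro x
    exact ⟨f.liftBaseChange R x ⊗ₜ ⟨u, huc⟩, hb.1 (hval _)⟩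

/-- The values of a solution `M → R` lie in the image of every solution ring mapping to `R`,
provided that the constants of `R` do. -/
lemma mem_range_of_isSolutionRing (f : M →ₗ[S] R) (hf : ∀ n m, f (dM.θ n m) = dR.θ n (f m))
    {R' : Type*} [CommRing R'] [Algebra S R'] {dR' : IterDer R'} (hsol : IsSolutionRing dM dR')
    (g : R' →ₐ[S] R) (hg : ∀ n x, g (dR'.θ n x) = dR.θ n (g x))
    (hc : ∀ c ∈ dR.constants, c ∈ g.range) (m : M) : f m ∈ g.range := by
  obtain ⟨_, h, hb⟩ := hsol
  obtain ⟨w, hw⟩ := hb.2 (1 ⊗ₜ m)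
  -- Writing `1 ⊗ m` through constant vectors `vᵢ` gives `f(m) = ∑ g(rᵢ) F(vᵢ)`, where `F` is the
  -- extension of `f` along `g`; each `F(vᵢ)` is a constant of `R`.
  have key : ∀ w, (LinearMap.mul' S R ∘ₗ TensorProduct.map g.toLinearMap f) (solutionMap dM h w)
      ∈ g.range := by
    intro w
    induction w with
    | zero => simp
    | add a b ha hb => rw [map_add, map_add]; exact add_mem ha hb
    | tmul r v =>
      rw [solutionMap, LinearMap.liftBaseChange_tmul, liftMap_smul]
      refine mul_mem ⟨r, rfl⟩ (hc _ fun n hn => ?_)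
      rw [← liftMap_baseChangeTheta dM h g hg f hf, Submodule.subtype_apply, v.2 n hn, map_zero]
  have h2 := key w
  rw [hw] at h2
  simpa using h2

/-- Some element of `R' ⊗ M` is mapped to a non-zero constant by every non-zero solution. -/
lemma exists_constant_ne_zero (f : M →ₗ[S] R) (hf : ∀ n m, f (dM.θ n m) = dR.θ n (f m))
    (hf0 : f ≠ 0)
    {R' : Type*} [CommRing R'] [Algebra S R'] {dR' : IterDer R'} (hsol : IsSolutionRing dM dR')
    (g : R' →ₐ[S] R) (hg : ∀ n x, g (dR'.θ n x) = dR.θ n (g x)) :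
    ∃ x : R' ⊗[S] M, (LinearMap.mul' S R ∘ₗ TensorProduct.map g.toLinearMap f) x ≠ 0 ∧
      (LinearMap.mul' S R ∘ₗ TensorProduct.map g.toLinearMap f) x ∈ dR.constants := by
  obtain ⟨_, h, hb⟩ := hsol
  by_contra! hne
  refine hf0 (LinearMap.ext fun m => ?_)
  obtain ⟨w, hw⟩ := hb.2 (1 ⊗ₜ m)
  have key : ∀ w, (LinearMap.mul' S R ∘ₗ TensorProduct.map g.toLinearMap f) (solutionMap dM h w)
      = 0 := by
    intro w
    induction w with
    | zero => simp
    | add a b ha hb => rw [map_add, map_add, ha, hb, add_zero]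
    | tmul r v =>
      rw [solutionMap, LinearMap.liftBaseChange_tmul, liftMap_smul, Submodule.subtype_apply]
      by_contra h0
      refine hne (v : R' ⊗[S] M) (fun h2 => h0 (by rw [h2, mul_zero])) fun n hn => ?_
      rw [← liftMap_baseChangeTheta dM h g hg f hf, v.2 n hn, map_zero]
  have h2 := key w
  rw [hw] at h2
  simpa using h2

end Solution

namespace RingS

/-! ### The solution of M in R and the minimality of R -/

section PicardVessiot

variable {C : Type u} [Field C]

/-- The generator `f₁` of `M`. -/
noncomputable def basisOne : ModM C := Submodule.Quotient.mk (1, 0)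

/-- The generator `f₂` of `M`. -/
noncomputable def basisTwo : ModM C := Submodule.Quotient.mk (0, 1)

lemma mk_eq_smul_basis (a b : RingS C) :
    (Submodule.Quotient.mk (a, b) : ModM C) = a • basisOne + b • basisTwo := by
  rw [basisOne, basisTwo, ← Submodule.Quotient.mk_smul, ← Submodule.Quotient.mk_smul,
    ← Submodule.Quotient.mk_add]
  simp

lemma t_smul_basisOne : t C • basisOne = s C • (basisTwo : ModM C) := by
  rw [basisOne, basisTwo, ← Submodule.Quotient.mk_smul, ← Submodule.Quotient.mk_smul,
    Submodule.Quotient.eq]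
  refine Submodule.subset_span (Or.inl ?_)
  simp

lemma t_smul_basisTwo : t C • (basisTwo : ModM C) = (s C ^ 2 - 1) • basisOne := by
  rw [eq_comm, basisOne, basisTwo, ← Submodule.Quotient.mk_smul, ← Submodule.Quotient.mk_smul,
    Submodule.Quotient.eq]
  refine Submodule.subset_span (Or.inr ?_)
  simp

variable [CharZero C] {z : C⟦X⟧ˣ}

/-- The solution `M → ⊕ Iⁿ zⁿ` with `f₁ ↦ s z` and `f₂ ↦ t z`. -/
noncomputable def solMap (z : C⟦X⟧ˣ) : ModM C →ₗ[RingS C] genRing z :=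
  (relations C).liftQ (LinearMap.coprod (LinearMap.toSpanSingleton (RingS C) _ (genS z))
    (LinearMap.toSpanSingleton (RingS C) _ (genT z))) (by
      rw [relations, Submodule.span_le]
      rintro x (rfl | rfl)
      · simp [s_smul_genT]
      · simp [t_smul_genT])

lemma solMap_mk (a b : RingS C) :
    solMap z (Submodule.Quotient.mk (a, b)) = a • genS z + b • genT z := rfl

lemma solMap_basisOne : solMap z basisOne = genS z := by
  rw [basisOne, solMap_mk, one_smul, zero_smul, add_zero]

lemma solMap_basisTwo : solMap z basisTwo = genT z := by
  rw [basisTwo, solMap_mk, one_smul, zero_smul, zero_add]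

/-- The element `u` is the preimage of `1` dictated by `genRing_partition`. The relations of `M`
give `(s z) u = 1 ⊗ f₁` and `(t z) u = 1 ⊗ f₂`, so every tensor is its image times `u`. -/
lemma bijective_solMap : Function.Bijective ((solMap z).liftBaseChange (genRing z)) := by
  set u : genRing z ⊗[RingS C] ModM C :=
    (s C • genInv z) ⊗ₜ basisOne - genQuot z ⊗ₜ basisTwo with hu
  have hr : ∀ (a : RingS C) (m : ModM C),
      (algebraMap (RingS C) (genRing z) a) ⊗ₜ[RingS C] m = 1 ⊗ₜ (a • m) := fun a m => by
    rw [Algebra.algebraMap_eq_smul_one, TensorProduct.smul_tmul]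
  have h1 : genS z • u = 1 ⊗ₜ basisOne := by
    rw [hu, smul_sub, TensorProduct.smul_tmul', TensorProduct.smul_tmul', smul_eq_mul, smul_eq_mul,
      mul_smul_comm, genS_mul_genInv, genS_mul_genQuot, Algebra.smul_def, ← map_mul, hr, hr,
      t_smul_basisTwo, ← TensorProduct.tmul_sub, ← sub_smul]
    congr 1
    rw [show s C * s C - (s C ^ 2 - 1) = 1 by ring, one_smul]
  have h2 : genT z • u = 1 ⊗ₜ basisTwo := by
    rw [hu, smul_sub, TensorProduct.smul_tmul', TensorProduct.smul_tmul', smul_eq_mul, smul_eq_mul,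
      mul_smul_comm, genT_mul_genInv, genT_mul_genQuot, Algebra.smul_def, ← map_mul, hr, hr,
      mul_smul, t_smul_basisOne, ← mul_smul, ← TensorProduct.tmul_sub, ← sub_smul]
    congr 1
    rw [show s C * s C - (s C ^ 2 - 1) = 1 by ring, one_smul]
  have h3 : ∀ m : ModM C, solMap z m • u = 1 ⊗ₜ m := by
    intro m
    obtain ⟨⟨a, b⟩, rfl⟩ := Submodule.Quotient.mk_surjective _ m
    rw [solMap_mk, mk_eq_smul_basis, add_smul, smul_assoc, smul_assoc, h1, h2,
      TensorProduct.tmul_add, TensorProduct.tmul_smul, TensorProduct.tmul_smul]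
  have h4 : ∀ x, (solMap z).liftBaseChange (genRing z) x • u = x := by
    intro x
    induction x with
    | zero => simp
    | add a b ha hb => rw [map_add, add_smul, ha, hb]
    | tmul r m =>
      rw [LinearMap.liftBaseChange_tmul, smul_assoc, h3, TensorProduct.smul_tmul', smul_eq_mul,
        mul_one]
  refine ⟨fun x y h => by rw [← h4 x, h, h4 y], fun r => ⟨r • u, ?_⟩⟩
  have h5 : (solMap z).liftBaseChange (genRing z) u = 1 := by
    rw [hu, map_sub, LinearMap.liftBaseChange_tmul, LinearMap.liftBaseChange_tmul,
      solMap_basisOne, solMap_basisTwo, smul_eq_mul, smul_eq_mul, genRing_partition]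
  rw [map_smul, h5, smul_eq_mul, mul_one]

variable (hz : sSeries C * PowerSeries.derivative C z = tSeries C * z)
include hz

lemma solMap_modDer (m : ModM C) : ((solMap z (modDer 0 m) : genRing z) : C⟦X⟧)
    = PowerSeries.derivative C (solMap z m : C⟦X⟧) := by
  obtain ⟨⟨a, b⟩, rfl⟩ := Submodule.Quotient.mk_surjective _ m
  change ((solMap z (Submodule.Quotient.mk (freeDer 0 (a, b))) : genRing z) : C⟦X⟧) = _
  rw [freeDer]
  change ((solMap z (Submodule.Quotient.mk (der C a + a * 0 + b * s C,
    der C b + a * ((3 * s C ^ 2 + 1) * discInv C) + b * 0)) : genRing z) : C⟦X⟧) = _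
  rw [solMap_mk, solMap_mk]
  change _ = PowerSeries.derivative C (a • (genS z : C⟦X⟧) + b • (genT z : C⟦X⟧))
  rw [map_add, derivative_smul, derivative_smul, derivative_genS hz, derivative_genT hz]
  change (der C a + a * 0 + b * s C) • (genS z : C⟦X⟧)
    + (der C b + a * ((3 * s C ^ 2 + 1) * discInv C) + b * 0) • (genT z : C⟦X⟧)
    = der C a • (genS z : C⟦X⟧) + a • (((3 * s C ^ 2 + 1) * discInv C) • (genT z : C⟦X⟧))
      + (der C b • (genT z : C⟦X⟧) + b • (s C • (genS z : C⟦X⟧)))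
  module

lemma solMap_θ (n : ℕ) (m : ModM C) :
    solMap z ((iterDerModule C 0).θ n m) = (genIterDer hz).θ n (solMap z m) := by
  refine Subtype.ext ?_
  let F : ModM C →ₗ[C] C⟦X⟧ :=
    ((genRing z).val.toLinearMap ∘ₗ solMap z).restrictScalars C
  have hF : ∀ k m, F ((modDer 0 ^ k) m) = ((PowerSeries.derivative C).toLinearMap ^ k) (F m) := by
    intro k
    induction k with
    | zero => intro m; simp
    | succ k ih =>
      intro m
      rw [pow_succ, Module.End.mul_apply, ih, pow_succ, Module.End.mul_apply]
      congr 1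
      exact solMap_modDer hz m
  change F ((n.factorial : C)⁻¹ • (modDer 0 ^ n) m) = _
  rw [map_smul, hF]
  rfl

/-- For minimality, the image of a solution ring contains the values `s z` and `t z` of the
solution. It also contains `1 / z` and `t / (s z)`, because some non-zero constant of `C` has the
form `g(a) s z + g(b) t z`. -/
lemma isPicardVessiotRing_genRing :
    IsPicardVessiotRing (iterDerModule C 0) (genIterDer hz) := by
  have hsimple := isSimple_genRing hz
  have := hsimple.1
  refine ⟨isSolutionRing_of_bijective _
    ((isIDExt_powerSeries C).restrict (genRing z) (θ_mem_genRing hz)) (solMap z) (solMap_θ hz)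
    bijective_solMap, hsimple, constants_genRing hz, ?_⟩
  intro R' _ _ dR' hsol g hg hinj
  refine ⟨hinj, ?_⟩
  have hc : ∀ c ∈ (genIterDer hz).constants, c ∈ g.range := by
    intro c hc
    obtain ⟨c, rfl⟩ := eq_algebraMap_of_mem_constants hz hc
    rw [IsScalarTower.algebraMap_apply C (RingS C) (genRing z)]
    exact g.range.algebraMap_mem _
  have h0 : solMap z ≠ 0 := fun h0 => by
    have h1 := solMap_basisOne (z := z)
    rw [h0, LinearMap.zero_apply, eq_comm] at h1
    have h2 := congrArg (fun x : genRing z => (x : C⟦X⟧)) h1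
    exact mul_ne_zero sSeries_ne_zero z.ne_zero h2
  obtain ⟨x, hx0, hxc⟩ := exists_constant_ne_zero (iterDerModule C 0) (solMap z) (solMap_θ hz) h0
    hsol g hg
  obtain ⟨c, hcx⟩ := eq_algebraMap_of_mem_constants hz hxc
  have hexp : ∀ x : R' ⊗[RingS C] ModM C, ∃ a b : R',
      (LinearMap.mul' (RingS C) (genRing z) ∘ₗ TensorProduct.map g.toLinearMap (solMap z)) x
        = g a * genS z + g b * genT z := by
    intro x
    induction x with
    | zero => exact ⟨0, 0, by simp⟩
    | add x y hx hy =>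
      obtain ⟨a, b, h⟩ := hx
      obtain ⟨a', b', h'⟩ := hy
      exact ⟨a + a', b + b', by rw [map_add, h, h', map_add, map_add]; ring⟩
    | tmul r m =>
      obtain ⟨⟨a, b⟩, rfl⟩ := Submodule.Quotient.mk_surjective _ m
      refine ⟨a • r, b • r, ?_⟩
      rw [LinearMap.comp_apply, TensorProduct.map_tmul, LinearMap.mul'_apply, solMap_mk,
        AlgHom.toLinearMap_apply, map_smul, map_smul]
      simp only [mul_add, mul_smul_comm, smul_mul_assoc]
  obtain ⟨a, b, hab⟩ := hexp x
  have hc0 : c ≠ 0 := by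
    rintro rfl
    exact hx0 (by rw [hcx, map_zero])
  have hab' : g a * genS z + g b * genT z = algebraMap C (genRing z) c := hab.symm.trans hcx
  have hdiv : ∀ y : genRing z, algebraMap C (genRing z) c * y ∈ g.range → y ∈ g.range := by
    intro y hy
    have h1 : y = algebraMap C (genRing z) c⁻¹ * (algebraMap C (genRing z) c * y) := by
      rw [← mul_assoc, ← map_mul, inv_mul_cancel₀ hc0, map_one, one_mul]
    rw [h1]
    refine mul_mem ?_ hy
    rw [IsScalarTower.algebraMap_apply C (RingS C) (genRing z)]
    exact g.range.algebraMap_mem _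
  intro y
  refine genRing_induction (p := fun y => y ∈ g.range) (fun a => g.range.algebraMap_mem a)
    ?_ ?_ (hdiv _ ?_) (hdiv _ ?_) (fun _ _ => add_mem) (fun _ _ => mul_mem) y
  · rw [← solMap_basisOne]
    exact mem_range_of_isSolutionRing _ (solMap z) (solMap_θ hz) hsol g hg hc _
  · rw [← solMap_basisTwo]
    exact mem_range_of_isSolutionRing _ (solMap z) (solMap_θ hz) hsol g hg hc _
  -- Multiplying the constant `g(a) s z + g(b) t z` by `1 / z` leaves `g(a) s + g(b) t`, which is in
  -- the image; multiplying by `t / (s z)` works in the same way.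
  · rw [← hab', add_mul, mul_assoc, mul_assoc, genS_mul_genInv, genT_mul_genInv]
    exact add_mem (mul_mem ⟨a, rfl⟩ (g.range.algebraMap_mem _))
      (mul_mem ⟨b, rfl⟩ (g.range.algebraMap_mem _))
  · rw [← hab', add_mul, mul_assoc, mul_assoc, genS_mul_genQuot, genT_mul_genQuot]
    exact add_mem (mul_mem ⟨a, rfl⟩ (g.range.algebraMap_mem _))
      (mul_mem ⟨b, rfl⟩ (g.range.algebraMap_mem _))

end PicardVessiot

end RingS

/-! ### The ID-Galois group -/

namespace RingS

section Galois

variable {C : Type u} [Field C] [CharZero C] {z : C⟦X⟧ˣ}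
  (hz : sSeries C * PowerSeries.derivative C z = tSeries C * z)

lemma isIDExt_genRing : IsIDExt (IterDer.trivial C) (genIterDer hz) :=
  (isIDExt C).comp ((isIDExt_powerSeries C).restrict (genRing z) (θ_mem_genRing hz))

/-- Stability of the grading is what makes the scaling by `dⁿ` in degree `n` commute with the
iterative derivation. -/
lemma θ_mem_grade {n : ℤ} {x : genRing z} (hx : x ∈ grade z n) (k : ℕ) :
    (genIterDer hz).θ k x ∈ grade z n :=
  θ_mem_of_derivative_mem (homog z n)
    (fun c x hx => by
      rw [← algebraMap_smul (RingS C) c x]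
      exact (homog z n).smul_mem _ hx)
    (fun _ hx => derivative_mem_homog hz hx) k hx

/-! ### The action of the units of D and its bijectivity onto the Galois group -/

section Scale

variable {D : Type v} [CommRing D] [Algebra C D]

/-- The coaction `r ↦ r ⊗ dⁿ` for `r` of degree `n`. -/
noncomputable def coact (d : Dˣ) : genRing z →ₐ[C] genRing z ⊗[C] D :=
  letI := gradedAlgebra hz
  (DirectSum.toAlgebra C (fun i => grade z i)
    (fun i => ((TensorProduct.mk C (genRing z) D).flip ((d ^ i : Dˣ) : D)).comp
      (grade z i).subtype)
    (by
      change (1 : genRing z) ⊗ₜ[C] ((d ^ (0 : ℤ) : Dˣ) : D) = 1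
      rw [zpow_zero]
      rfl)
    (by
      intro i j x y
      change ((x : genRing z) * (y : genRing z)) ⊗ₜ[C] ((d ^ (i + j) : Dˣ) : D)
        = ((x : genRing z) ⊗ₜ[C] ((d ^ i : Dˣ) : D)) * ((y : genRing z) ⊗ₜ[C] ((d ^ j : Dˣ) : D))
      rw [Algebra.TensorProduct.tmul_mul_tmul, zpow_add, Units.val_mul])).comp
    (DirectSum.decomposeAlgEquiv (grade z)).toAlgHom

lemma coact_apply (d : Dˣ) {n : ℤ} {x : genRing z} (hx : x ∈ grade z n) :
    coact hz d x = x ⊗ₜ ((d ^ n : Dˣ) : D) := by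
  let _ := gradedAlgebra hz
  have h : (DirectSum.decomposeAlgEquiv (grade z)).toAlgHom x
      = DirectSum.of (fun i => grade z i) n ⟨x, hx⟩ := DirectSum.decompose_of_mem _ hx
  unfold coact
  rw [AlgHom.comp_apply]
  erw [h]
  exact DirectSum.toAddMonoid_of (fun i =>
    (((TensorProduct.mk C (genRing z) D).flip ((d ^ i : Dˣ) : D)).comp
      (grade z i).subtype).toAddMonoidHom) n ⟨x, hx⟩

/-- The endomorphism of `R ⊗ D` given by `r ⊗ x ↦ r ⊗ dⁿ x` for `r` of degree `n`. -/
noncomputable def scaleHom (d : Dˣ) : genRing z ⊗[C] D →ₐ[C] genRing z ⊗[C] D :=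
  Algebra.TensorProduct.lift (coact hz d) Algebra.TensorProduct.includeRight
    (fun _ _ => Commute.all _ _)

lemma scaleHom_tmul (d : Dˣ) {n : ℤ} {r : genRing z} (hr : r ∈ grade z n) (x : D) :
    scaleHom hz d (r ⊗ₜ x) = r ⊗ₜ (((d ^ n : Dˣ) : D) * x) := by
  rw [scaleHom, Algebra.TensorProduct.lift_tmul, coact_apply hz d hr,
    Algebra.TensorProduct.includeRight_apply, Algebra.TensorProduct.tmul_mul_tmul, mul_one]

include hz in
lemma tensor_induction {p : genRing z ⊗[C] D → Prop}
    (h : ∀ (n : ℤ) (r : genRing z) (x : D), r ∈ grade z n → p (r ⊗ₜ x))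
    (hadd : ∀ x y, p x → p y → p (x + y)) (x : genRing z ⊗[C] D) : p x := by
  let _ := gradedAlgebra hz
  have h0 : p 0 := by simpa using h 0 0 0 (Submodule.zero_mem _)
  induction x with
  | zero => exact h0
  | add a b ha hb => exact hadd _ _ ha hb
  | tmul r x =>
    induction r using DirectSum.Decomposition.inductionOn (grade z) with
    | zero => rwa [TensorProduct.zero_tmul]
    | homogeneous r => exact h _ _ _ r.2
    | add a b ha hb => rw [TensorProduct.add_tmul]; exact hadd _ _ ha hb

lemma scaleHom_one (x : genRing z ⊗[C] D) : scaleHom hz 1 x = x := by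
  induction x using tensor_induction hz with
  | h n r x hr => rw [scaleHom_tmul hz _ hr, one_zpow, Units.val_one, one_mul]
  | hadd x y hx hy => rw [map_add, hx, hy]

lemma scaleHom_mul (d e : Dˣ) (x : genRing z ⊗[C] D) :
    scaleHom hz (d * e) x = scaleHom hz d (scaleHom hz e x) := by
  induction x using tensor_induction hz with
  | h n r x hr =>
    rw [scaleHom_tmul hz _ hr, scaleHom_tmul hz _ hr, scaleHom_tmul hz _ hr, mul_zpow,
      Units.val_mul, mul_assoc]
  | hadd x y hx hy => rw [map_add, map_add, map_add, hx, hy]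

lemma scaleHom_mem (d : Dˣ) : (∀ x : RingS C ⊗[C] D, scaleHom hz d (scalarMap (RingS C) D x)
      = scalarMap (RingS C) D x) ∧
    ∀ k x, scaleHom hz d (scalarTheta (isIDExt_genRing hz) D k x)
      = scalarTheta (isIDExt_genRing hz) D k (scaleHom hz d x) := by
  constructor
  · intro x
    induction x with
    | zero => simp
    | add a b ha hb => rw [map_add, map_add, ha, hb]
    | tmul a x =>
      change scaleHom hz d (algebraMap (RingS C) (genRing z) a ⊗ₜ x)
        = algebraMap (RingS C) (genRing z) a ⊗ₜ x
      rw [scaleHom_tmul hz d (algebraMap_mem_grade a), zpow_zero, Units.val_one, one_mul]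
  · intro k x
    induction x using tensor_induction hz with
    | h n r x hr =>
      rw [scalarTheta_tmul, scaleHom_tmul hz _ hr, scalarTheta_tmul,
        scaleHom_tmul hz _ (θ_mem_grade hz hr k)]
    | hadd x y hx hy => simp only [map_add, hx, hy]

/-- The action of the units of `D` on `R ⊗ D`. -/
noncomputable def scale (D : Type v) [CommRing D] [Algebra C D] :
    Dˣ →* galGroup (RingS C) (isIDExt_genRing hz) D where
  toFun d := ⟨AlgEquiv.ofAlgHom (scaleHom hz d) (scaleHom hz d⁻¹)
    (AlgHom.ext fun x => by
      rw [AlgHom.comp_apply, ← scaleHom_mul, mul_inv_cancel, scaleHom_one, AlgHom.id_apply])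
    (AlgHom.ext fun x => by
      rw [AlgHom.comp_apply, ← scaleHom_mul, inv_mul_cancel, scaleHom_one, AlgHom.id_apply]),
    scaleHom_mem hz d⟩
  map_one' := Subtype.ext (AlgEquiv.ext fun x => scaleHom_one hz x)
  map_mul' d e := Subtype.ext (AlgEquiv.ext fun x => scaleHom_mul hz d e x)

lemma scale_apply (d : Dˣ) (x : genRing z ⊗[C] D) : (scale hz D d).1 x = scaleHom hz d x := rfl

lemma scalarTheta_one_mul (x y : genRing z ⊗[C] D) :
    scalarTheta (isIDExt_genRing hz) D 1 (x * y)
      = scalarTheta (isIDExt_genRing hz) D 1 x * y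
        + x * scalarTheta (isIDExt_genRing hz) D 1 y := by
  induction x with
  | zero => simp
  | add a b ha hb => rw [add_mul, map_add, map_add, ha, hb]; ring
  | tmul r d =>
    induction y with
    | zero => simp
    | add a b ha hb => rw [mul_add, map_add, map_add, ha, hb]; ring
    | tmul r' d' =>
      simp only [Algebra.TensorProduct.tmul_mul_tmul, scalarTheta_tmul, IterDer.θ_mul,
        Nat.antidiagonal_succ, Nat.antidiagonal_zero]
      simp [TensorProduct.add_tmul, IterDer.θ_zero, add_comm]

/-- The derivation of `⊕ Iⁿ zⁿ`, as a linear map. -/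
noncomputable def genDer : genRing z →ₗ[C] genRing z where
  toFun x := (genIterDer hz).θ 1 x
  map_add' := map_add _
  map_smul' c x := Subtype.ext <| by
    change (powerSeriesIterDer C).θ 1 (c • (x : C⟦X⟧)) = c • (powerSeriesIterDer C).θ 1 (x : C⟦X⟧)
    rw [powerSeries_θ_one, powerSeries_θ_one, Derivation.map_smul]

lemma exact_genDer : Function.Exact (Algebra.linearMap C (genRing z)) (genDer hz) := by
  intro x
  constructor
  · intro hx
    have h1 : PowerSeries.derivative C (x : C⟦X⟧) = 0 := by
      rw [← powerSeries_θ_one]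
      exact congrArg (fun x : genRing z => (x : C⟦X⟧)) hx
    obtain ⟨c, rfl⟩ := eq_algebraMap_of_derivative_eq_zero h1
    exact ⟨c, rfl⟩
  · rintro ⟨c, rfl⟩
    exact algebraMap_mem_constants hz c 1 one_pos

/-- Tensoring with `D`, flat over the field `C`, preserves the exact sequence `C → R → R` given by
the derivation. So the kernel on `R ⊗ D` is the image of `C ⊗ D`. -/
lemma exists_one_tmul_of_scalarTheta_eq_zero {x : genRing z ⊗[C] D}
    (hx : scalarTheta (isIDExt_genRing hz) D 1 x = 0) : ∃ d : D, x = 1 ⊗ₜ d := by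
  have h1 : (genDer hz).rTensor D x = 0 := by
    rw [← hx]
    clear hx
    induction x with
    | zero => simp
    | add a b ha hb => rw [map_add, map_add, ha, hb]
    | tmul r d => rw [LinearMap.rTensor_tmul, scalarTheta_tmul]; rfl
  obtain ⟨y, rfl⟩ := (Module.Flat.rTensor_exact D (exact_genDer hz) x).1 h1
  clear hx h1
  induction y with
  | zero => exact ⟨0, by simp⟩
  | add a b ha hb =>
    obtain ⟨d, hd⟩ := ha
    obtain ⟨e, he⟩ := hb
    exact ⟨d + e, by rw [map_add, hd, he, TensorProduct.tmul_add]⟩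
  | tmul c d =>
    refine ⟨c • d, ?_⟩
    rw [LinearMap.rTensor_tmul, Algebra.linearMap_apply, Algebra.algebraMap_eq_smul_one,
      TensorProduct.smul_tmul]

lemma one_tmul_injective : Function.Injective fun d : D => (1 : genRing z) ⊗ₜ[C] d :=
  Algebra.TensorProduct.includeRight_injective (algebraMap C (genRing z)).injective

lemma partition_tmul : ((s C • genInv z) ⊗ₜ[C] (1 : D)) * (genS z ⊗ₜ 1)
    - (genQuot z ⊗ₜ 1) * (genT z ⊗ₜ 1) = (1 : genRing z ⊗[C] D) := by
  rw [Algebra.TensorProduct.tmul_mul_tmul, Algebra.TensorProduct.tmul_mul_tmul, mul_one,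
    ← TensorProduct.sub_tmul, genRing_partition]
  rfl

/-- If `(x, y)` satisfies the relations of `M`, then `σ p x - q y`, with `p` and `q` in the roles of
`1 / z` and `t / (s z)`, is the factor by which `(x, y)` is a multiple of `(s z, t z)`. This lemma
and the next treat the two coordinates. -/
lemma sub_mul_eq_left {T : Type*} [CommRing T] {σ τ p q x y g : T} (h : g * p = σ)
    (h' : g * q = τ) (h'' : τ * y = (σ ^ 2 - 1) * x) : (σ * p * x - q * y) * g = x := by
  linear_combination σ * x * h - y * h' - h''

lemma sub_mul_eq_right {T : Type*} [CommRing T] {σ τ p q x y g : T} (h : g * p = τ)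
    (h' : g * q = σ ^ 2 - 1) (h'' : σ * y = τ * x) : (σ * p * x - q * y) * g = y := by
  linear_combination σ * x * h - y * h' - σ * h''

/-- An ID-automorphism of `R ⊗ D` over `S ⊗ D` multiplies `s z` and `t z` by the same element
of `D`. -/
lemma exists_scalar {σ : (genRing z ⊗[C] D) ≃ₐ[C] (genRing z ⊗[C] D)}
    (hσ : σ ∈ galGroup (RingS C) (isIDExt_genRing hz) D) :
    ∃ d : D, σ (genS z ⊗ₜ 1) = genS z ⊗ₜ d ∧ σ (genT z ⊗ₜ 1) = genT z ⊗ₜ d := by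
  let κ : RingS C →+* genRing z ⊗[C] D :=
    (Algebra.TensorProduct.includeLeft (R := C) (S := C)).toRingHom.comp
      (algebraMap (RingS C) (genRing z))
  have hκ : ∀ (a : RingS C) (x : genRing z), (a • x) ⊗ₜ[C] (1 : D) = κ a * (x ⊗ₜ 1) := by
    intro a x
    change _ = (algebraMap (RingS C) (genRing z) a ⊗ₜ 1) * _
    rw [Algebra.TensorProduct.tmul_mul_tmul, mul_one, Algebra.smul_def]
  have hκm : ∀ (a : RingS C) (x y : genRing z), x * y = algebraMap (RingS C) (genRing z) a →
      (x ⊗ₜ[C] (1 : D)) * (y ⊗ₜ 1) = κ a := by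
    intro a x y h
    rw [Algebra.TensorProduct.tmul_mul_tmul, mul_one, h]
    rfl
  have hσκ : ∀ a, σ (κ a) = κ a := fun a => by simpa [scalarMap] using! hσ.1 (a ⊗ₜ 1)
  have hσs : ∀ (a : RingS C) (x : genRing z),
      σ ((a • x) ⊗ₜ[C] (1 : D)) = κ a * σ (x ⊗ₜ 1) := fun a x => by rw [hκ, map_mul, hσκ]
  have e1 := congrArg (fun x => σ (x ⊗ₜ[C] (1 : D))) (s_smul_genT (z := z))
  have e2 := congrArg (fun x => σ (x ⊗ₜ[C] (1 : D))) (t_smul_genT (z := z))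
  simp only [hσs] at e1 e2
  have m1 := hκm _ _ _ (genS_mul_genInv (z := z))
  have m2 := hκm _ _ _ (genT_mul_genInv (z := z))
  have m3 := hκm _ _ _ (genS_mul_genQuot (z := z))
  have m4 := hκm _ _ _ (genT_mul_genQuot (z := z))
  have θS : (genIterDer hz).θ 1 (genS z) = ((3 * s C ^ 2 + 1) * discInv C) • genT z :=
    Subtype.ext ((powerSeries_θ_one _).trans (derivative_genS hz))
  have θT : (genIterDer hz).θ 1 (genT z) = s C • genS z :=
    Subtype.ext ((powerSeries_θ_one _).trans (derivative_genT hz))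
  have hpart := partition_tmul (z := z) (D := D)
  have d1 := hσ.2 1 (genS z ⊗ₜ 1)
  have d2 := hσ.2 1 (genT z ⊗ₜ 1)
  rw [scalarTheta_tmul, θS, hσs] at d1
  rw [scalarTheta_tmul, θT, hσs] at d2
  rw [hκ] at hpart
  rw [map_sub, map_pow, map_one] at m4 e2
  set S' := σ (genS z ⊗ₜ 1)
  set T' := σ (genT z ⊗ₜ 1)
  -- Formally `c` is the ratio `σ(s z) / (s z) = σ(t z) / (t z)`, written without division by means
  -- of `genRing_partition`.
  set c := κ (s C) * (genInv z ⊗ₜ 1) * S' - (genQuot z ⊗ₜ 1) * T' with hc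
  have c1 : c * (genS z ⊗ₜ 1) = S' := by
    rw [hc]
    exact sub_mul_eq_left (T := genRing z ⊗[C] D) m1 m3 e2
  have c2 : c * (genT z ⊗ₜ 1) = T' := by
    rw [hc]
    exact sub_mul_eq_right (T := genRing z ⊗[C] D) m2 m4 e1
  have f1 := scalarTheta_one_mul hz c (genS z ⊗ₜ 1)
  have f2 := scalarTheta_one_mul hz c (genT z ⊗ₜ 1)
  rw [c1, scalarTheta_tmul, θS, hκ, ← d1] at f1
  rw [c2, scalarTheta_tmul, θT, hκ, ← d2] at f2
  -- The image pair satisfies the same differential system as `(s z, t z)`, so the product rule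
  -- leaves `∂(c) · s z = 0` and `∂(c) · t z = 0`. The partition of unity then yields `∂(c) = 0`.
  have hc0 : scalarTheta (isIDExt_genRing hz) D 1 c = 0 := by
    linear_combination (-scalarTheta (isIDExt_genRing hz) D 1 c) * hpart
      - κ (s C) * (genInv z ⊗ₜ 1) * f1 + (genQuot z ⊗ₜ 1) * f2
      - κ (s C) * (genInv z ⊗ₜ 1) * κ ((3 * s C ^ 2 + 1) * discInv C) * c2
      + (genQuot z ⊗ₜ 1) * κ (s C) * c1
  obtain ⟨d, hd⟩ := exists_one_tmul_of_scalarTheta_eq_zero hz hc0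
  refine ⟨d, ?_, ?_⟩
  · rw [← c1, hd, Algebra.TensorProduct.tmul_mul_tmul, one_mul, mul_one]
  · rw [← c2, hd, Algebra.TensorProduct.tmul_mul_tmul, one_mul, mul_one]

lemma eq_of_genS_tmul_eq {d e : D} (h1 : genS z ⊗ₜ[C] d = genS z ⊗ₜ e)
    (h2 : genT z ⊗ₜ[C] d = genT z ⊗ₜ e) : d = e := by
  refine one_tmul_injective (z := z) (C := C) ?_
  have key : ∀ d : D, (1 : genRing z) ⊗ₜ[C] d = ((s C • genInv z) ⊗ₜ 1) * (genS z ⊗ₜ d)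
      - (genQuot z ⊗ₜ 1) * (genT z ⊗ₜ d) := fun d => by
    rw [Algebra.TensorProduct.tmul_mul_tmul, Algebra.TensorProduct.tmul_mul_tmul, one_mul,
      ← TensorProduct.sub_tmul, genRing_partition]
  simp only
  rw [key d, key e, h1, h2]

/-- An algebra homomorphism over `S` out of `⊕ Iⁿ zⁿ` is determined by the images of `s z` and
`t z`. -/
lemma genRing_hom_ext {T : Type*} [CommRing T] {f g : genRing z →+* T}
    (h : ∀ a, f (algebraMap (RingS C) _ a) = g (algebraMap (RingS C) _ a))
    (hS : f (genS z) = g (genS z)) (hT : f (genT z) = g (genT z)) : f = g := by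
  -- An element whose products with `s z` and `t z` lie in `S` has its image forced, since the
  -- images of `s z` and `t z` generate the unit ideal. This covers the two generators of degree
  -- `-1`.
  have key : ∀ (x : genRing z) (a b : RingS C), genS z * x = algebraMap (RingS C) _ a →
      genT z * x = algebraMap (RingS C) _ b → f x = g x := by
    intro x a b ha hb
    have h1 := congrArg g (genRing_partition (z := z))
    have ha' := congrArg f ha
    have hb' := congrArg f hb
    have ha'' := congrArg g ha
    have hb'' := congrArg g hb
    simp only [map_sub, map_mul, map_one] at h1 ha' hb' ha'' hb''
    rw [h, hS] at ha'
    rw [h, hT] at hb'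
    linear_combination (g x - f x) * h1 + g (s C • genInv z) * (ha' - ha'')
      - g (genQuot z) * (hb' - hb'')
  refine RingHom.ext fun x => ?_
  refine genRing_induction (p := fun x => f x = g x) h hS hT
    (key _ _ _ genS_mul_genInv genT_mul_genInv) (key _ _ _ genS_mul_genQuot genT_mul_genQuot)
    (fun x y hx hy => by rw [map_add, map_add, hx, hy])
    (fun x y hx hy => by rw [map_mul, map_mul, hx, hy]) x

lemma galGroup_ext {σ τ : galGroup (RingS C) (isIDExt_genRing hz) D}
    (h1 : σ.1 (genS z ⊗ₜ 1) = τ.1 (genS z ⊗ₜ 1)) (h2 : σ.1 (genT z ⊗ₜ 1) = τ.1 (genT z ⊗ₜ 1)) :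
    σ = τ := by
  refine Subtype.ext (AlgEquiv.ext fun x => ?_)
  have key := genRing_hom_ext (z := z)
    (f := (σ.1.toAlgHom.comp (Algebra.TensorProduct.includeLeft (R := C) (S := C))).toRingHom)
    (g := (τ.1.toAlgHom.comp (Algebra.TensorProduct.includeLeft (R := C) (S := C))).toRingHom)
    (fun a => (σ.2.1 (a ⊗ₜ 1)).trans (τ.2.1 (a ⊗ₜ 1)).symm) h1 h2
  induction x with
  | zero => simp
  | add a b ha hb => rw [map_add, map_add, ha, hb]
  | tmul r d =>
    have h3 : r ⊗ₜ[C] d = (r ⊗ₜ[C] (1 : D)) * ((1 : genRing z) ⊗ₜ[C] d) := by simp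
    rw [h3, map_mul, map_mul, galGroup_one_tmul (RingS C) σ.2, galGroup_one_tmul (RingS C) τ.2]
    exact congrArg (· * _) (DFunLike.congr_fun key r)

lemma scale_genS (d : Dˣ) : (scale hz D d).1 (genS z ⊗ₜ 1) = genS z ⊗ₜ (d : D) := by
  rw [scale_apply, scaleHom_tmul hz d genS_mem_grade, zpow_one, mul_one]

lemma scale_genT (d : Dˣ) : (scale hz D d).1 (genT z ⊗ₜ 1) = genT z ⊗ₜ (d : D) := by
  rw [scale_apply, scaleHom_tmul hz d genT_mem_grade, zpow_one, mul_one]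

/-- An automorphism and its inverse scale `(s z, t z)` by elements `d` and `e` of `D`; comparing
shows `d e = 1`, so `d` is a unit. An automorphism is determined by its values on `s z` and `t z`.
-/
lemma bijective_scale (D : Type v) [CommRing D] [Algebra C D] :
    Function.Bijective (scale hz D) := by
  constructor
  · intro d e h
    exact Units.ext (eq_of_genS_tmul_eq (by rw [← scale_genS hz, h, scale_genS hz])
      (by rw [← scale_genT hz, h, scale_genT hz]))
  · intro σ
    have hmul : ∀ (τ : galGroup (RingS C) (isIDExt_genRing hz) D) (x : genRing z) (d e : D),
        τ.1 (x ⊗ₜ 1) = x ⊗ₜ d → τ.1 (x ⊗ₜ e) = x ⊗ₜ (d * e) := by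
      intro τ x d e h
      have h3 : x ⊗ₜ[C] e = (x ⊗ₜ[C] (1 : D)) * ((1 : genRing z) ⊗ₜ[C] e) := by simp
      rw [h3, map_mul, h, galGroup_one_tmul (RingS C) τ.2, Algebra.TensorProduct.tmul_mul_tmul,
        mul_one]
    have hinv : ∀ (τ : galGroup (RingS C) (isIDExt_genRing hz) D) {d e : D},
        τ.1 (genS z ⊗ₜ 1) = genS z ⊗ₜ d → τ.1 (genT z ⊗ₜ 1) = genT z ⊗ₜ d →
        τ⁻¹.1 (genS z ⊗ₜ 1) = genS z ⊗ₜ e → τ⁻¹.1 (genT z ⊗ₜ 1) = genT z ⊗ₜ e → d * e = 1 := by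
      intro τ d e h1 h2 h3 h4
      have h5 : ∀ x, τ.1 (τ⁻¹.1 x) = x := fun x => τ.1.apply_symm_apply x
      refine eq_of_genS_tmul_eq (z := z) (C := C) ?_ ?_
      · rw [← hmul τ _ d e h1, ← h3, h5]
      · rw [← hmul τ _ d e h2, ← h4, h5]
    obtain ⟨d, h1, h2⟩ := exists_scalar hz σ.2
    obtain ⟨e, h3, h4⟩ := exists_scalar hz (σ⁻¹).2
    have hde := hinv σ h1 h2 h3 h4
    refine ⟨⟨d, e, hde, by rw [mul_comm]; exact hde⟩, galGroup_ext hz ?_ ?_⟩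
    · rw [scale_genS, h1]
    · rw [scale_genT, h2]

end Scale

lemma galMap_scale {D D' : Type v} [CommRing D] [CommRing D'] [Algebra C D] [Algebra C D']
    (f : D →ₐ[C] D') (d : Dˣ) : galMap (RingS C) (isIDExt_genRing hz) f (scale hz D d)
      = scale hz D' (Units.map f d) := by
  refine galGroup_ext hz ?_ ?_
  · change scalarExtend f (scale hz D d).1.toAlgHom (genS z ⊗ₜ 1) = _
    rw [scale_genS, scalarExtend_tmul]
    change scalarChange _ f ((scale hz D d).1 (genS z ⊗ₜ 1)) * _ = _
    rw [scale_genS, Algebra.TensorProduct.map_tmul, Algebra.TensorProduct.tmul_mul_tmul]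
    simp
  · change scalarExtend f (scale hz D d).1.toAlgHom (genT z ⊗ₜ 1) = _
    rw [scale_genT, scalarExtend_tmul]
    change scalarChange _ f ((scale hz D d).1 (genT z ⊗ₜ 1)) * _ = _
    rw [scale_genT, Algebra.TensorProduct.map_tmul, Algebra.TensorProduct.tmul_mul_tmul]
    simp

/-- The ID-Galois group of `⊕ Iⁿ zⁿ` is the multiplicative group. -/
noncomputable def galFunctorIso :
    CategoryTheory.Iso (galFunctor (RingS C) (isIDExt_genRing hz)) (gmFunctor C) :=
  (CategoryTheory.NatIso.ofComponents (F := gmFunctor C)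
    (G := galFunctor (RingS C) (isIDExt_genRing hz))
    (fun D : CommAlgCat.{u} C =>
      (MulEquiv.ofBijective (scale hz D) (bijective_scale hz D)).toGrpIso)
    (fun {D D'} f => by
      refine GrpCat.hom_ext (MonoidHom.ext fun (d : Dˣ) => ?_)
      change scale hz D' (Units.map (f.hom : D →ₐ[C] D').toMonoidHom d)
        = galMap (RingS C) (isIDExt_genRing hz) f.hom (scale hz D d)
      exact (galMap_scale (D := D) (D' := D') hz f.hom d).symm)).symm

end Galois

end RingS

/-! ### Assembly of the theorem -/

theorem mainTheorem5 (C : Type u) [Field C] [CharZero C] :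
    (RingS.iterDer C).IsSimple ∧
    (RingS.iterDer C).constants = (algebraMap C (RingS C)).range ∧
    (∃ y : C⟦X⟧, RingS.IsSolution (0 : RingS C) y) ∧
    ∀ y : C⟦X⟧, RingS.IsSolution (0 : RingS C) y →
      Transcendental (RingS C) y ∧
      Transcendental (RingS C) (y * (RingS.sSeries C)⁻¹) ∧
      (∀ n : ℕ, 0 < n → ∀ a b : RingS C, b ≠ 0 →
        (algebraMap C⟦X⟧ (FractionRing C⟦X⟧) y /
            algebraMap C⟦X⟧ (FractionRing C⟦X⟧) (RingS.sSeries C)) ^ n ≠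
          algebraMap C⟦X⟧ (FractionRing C⟦X⟧) (algebraMap (RingS C) C⟦X⟧ a) /
            algebraMap C⟦X⟧ (FractionRing C⟦X⟧) (algebraMap (RingS C) C⟦X⟧ b)) ∧
      ∃ h : ∀ n, ∀ x ∈ RingS.pvRing y, (powerSeriesIterDer C).θ n x ∈ RingS.pvRing y,
        IsPicardVessiotRing (RingS.iterDerModule C 0)
          ((powerSeriesIterDer C).restrict (RingS.pvRing y) h) ∧
        Nonempty (CategoryTheory.Iso
          (galFunctor (RingS C)
            ((RingS.isIDExt C).comp
              ((RingS.isIDExt_powerSeries C).restrict (RingS.pvRing y) h)))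
          (gmFunctor C)) := by
  refine ⟨RingS.isSimple, RingS.constants_eq, exists_derivative_eq_mul _, fun y hy => ?_⟩
  obtain ⟨z, hyz, hyi, hz⟩ := hy.exists_unit
  have hy1 : y ∈ RingS.homog z 1 := by
    rw [hyz]
    exact RingS.mem_grade.1 RingS.genS_mem_grade
  have hzy : y * (RingS.sSeries C)⁻¹ = z := by
    rw [hyz]
    linear_combination (z : C⟦X⟧) * RingS.sSeries_mul_inv (C := C)
  have hz1 : (z : C⟦X⟧) ∈ RingS.homog z 1 := by
    simpa using RingS.smul_zpow_mem_homog (z := z) 1 1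
  refine ⟨RingS.transcendental_of_mem_homog hz hy.1 hy1, ?_, ?_, ?_⟩
  · rw [hzy]
    exact RingS.transcendental_of_mem_homog hz z.ne_zero hz1
  · intro n hn a b hb h
    have hinj := IsFractionRing.injective C⟦X⟧ (FractionRing C⟦X⟧)
    refine RingS.mul_pow_ne_of_mem_homog hz z.ne_zero hz1 hn a hb (hinj ?_)
    have hs : algebraMap C⟦X⟧ (FractionRing C⟦X⟧) (RingS.sSeries C) ≠ 0 := by
      rw [Ne, map_eq_zero_iff _ hinj]
      exact RingS.sSeries_ne_zero
    have hb' : algebraMap C⟦X⟧ (FractionRing C⟦X⟧) (algebraMap (RingS C) C⟦X⟧ b) ≠ 0 := by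
      rw [Ne, map_eq_zero_iff _ hinj, map_eq_zero_iff _ RingS.algebraMap_injective]
      exact hb
    rw [hyz, map_mul, mul_div_cancel_left₀ _ hs, eq_div_iff hb'] at h
    rw [map_mul, map_pow, mul_comm, h]
  · rw [RingS.pvRing_eq z hyz hyi]
    exact ⟨RingS.θ_mem_genRing hz, RingS.isPicardVessiotRing_genRing hz,
      ⟨RingS.galFunctorIso hz⟩⟩
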